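/- **Setting.** Let $d,M\ge 1$ be integers, $\mathcal S=\{1,\dots,M\}^d\subset\mathbb R^d$, and let $d_0,L\ge1$ be integers with $d_0\mid d+1$, $\,d+1\mid M$ and $M=d_0L$. Let $\kappa:[0,1]\to\mathbb R$ be smooth with $\kappa_0=0$, $\kappa_1=1$ and $\dot\kappa_t>0$ on $(0,1)$, and let $0<t_0<T<1$. Let $(X_0,X_1)$ be a random pair in $\mathcal S\times\mathcal S$ with an arbitrary joint law $\pi$. The mixture path is $$p_{t|0,1}(x|x_0,x_1)=\prod_{j=1}^d\big(\kappa_t\,\delta(x^j,x_1^j)+(1-\kappa_t)\,\delta(x^j,x_0^j)\big),\qquad p_t(x)=\sum_{x_0,x_1}p_{t|0,1}(x|x_0,x_1)\,\pi(x_0,x_1).$$ For a coordinate $i\in\{1,\dots,d\}$, the factorized velocity $u^i(x,t)\in\mathbb R^M$ has the entries, $y\in\{1,\dots,M\}$, $$u^i(x,t)_y=\frac{\dot\kappa_t}{1-\kappa_t}\;\mathbb E\big[\delta(y,X_1^i)-\delta(y,x^i)\big],$$ where the expectation is over the conditional law of $(X_0,X_1)$ given $X_t=x$, that is, proportional to $p_{t|0,1}(x|x_0,x_1)\pi(x_0,x_1)$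 (with $u^i(x,t)=0$ if $p_t(x)=0$). The result is claimed also for the field given by the same formula with the expectation over the unconditional law of $X_1$. **Hölder smoothness in time.** For some $\beta\ge1$, $k=\lfloor\beta\rfloor$, and for every $x\in\mathcal S$ and $y$, the function $f(t)=u^i(x,t)_y$ is $k$ times differentiable on $[t_0,T]$ with $$\sum_{j=0}^{k}\sup_{[t_0,T]}|f^{(j)}|+\sup_{s\ne t}\frac{|f^{(k)}(s)-f^{(k)}(t)|}{|s-t|^{\beta-k}}\le K.$$ **Networks.** On $\mathbb R^{d_0\times L}$ let $F^{\rm FF}(Z)=Z+W_2\,\mathrm{ReLU}(W_1Z+b_1\mathbf 1^\top)+b_2\mathbf 1^\top$ (hidden dimension $r$), $F^{\rm SA}(Z)=Z+\sum_{n=1}^hW_O^nW_V^nZ\,\mathrm{Softmax}((W_K^nZ)^\top W_Q^nZ)$ ($h$ heads, hidden dimension $s$, column-wise softmax), and $F^{\rm E}(Z)=Z+E$. Let $R_1:\mathbb R^{d+1}\to\mathbb R^{d_0\times L}$ cut a vector into consecutive columns of length $d_0$ and repeat the resulting $d_0\times\frac{d+1}{d_0}$ matrix along the columns $\frac M{d+1}$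 times, and let $R_2:\mathbb R^{d_0\times L}\to\mathbb R^{M}$ concatenate the columns. Write $W_{KQ}^n=(W_K^n)^\top W_Q^n$ and $W_{OV}^n=W_O^nW_V^n$; $\|\cdot\|_2$ is the spectral norm and $\|\cdot\|_{2,\infty}$ the largest Euclidean norm of a row. The class $\mathcal T_R^{h,s,r}$ with bounds $C_{\mathcal T},C_{KQ}^{2,\infty},C_{KQ},C_{OV}^{2,\infty},C_{OV},C_E,C_F^{2,\infty},C_F,L_{\mathcal T}$ consists of the maps $R_2\circ f\circ F^{\rm E}\circ R_1$ where $f$ is a composition of one or more blocks $F^{\rm FF}\circ F^{\rm SA}$, $\|f\|_F\le C_{\mathcal T}$ everywhere, $f$ is $L_{\mathcal T}$-Lipschitz in the Frobenius norm, $\|E^\top\|_{2,\infty}\le C_E$, and in every layer and head $\|W_1\|_2,\|W_2\|_2\le C_F$, $\|W_1\|_{2,\infty},\|W_2\|_{2,\infty}\le C_F^{2,\infty}$, $\|W_{KQ}^n\|_2\le C_{KQ}$, $\|W_{KQ}^n\|_{2,\infty}\le C_{KQ}^{2,\infty}$, $\|W_{OV}^n\|_2\le C_{OV}$, $\|W_{OV}^n\|_{2,\infty}\le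 C_{OV}^{2,\infty}$. **Theorem.** For every $K>0$ there are $c>0$ and $p,q\in\mathbb N$, depending only on $K$, such that the following holds for all data as above, with $C:=c\,(d\,d_0)^p$. For every $\epsilon\in(0,1)$ there are $h,s,r\ge1$, finite $C_{\mathcal T},L_{\mathcal T}$, and a network $u^i_\theta\in\mathcal T_R^{h,s,r}$ with $$C_{KQ}=C_{KQ}^{2,\infty}=C\,(\log M)^q\,M^{6d_0+3}\epsilon^{-4d_0-2},\quad C_{OV}=C_{OV}^{2,\infty}=C\,M^{-1/2}\epsilon,\quad C_F=C_F^{2,\infty}=C\,M^2\epsilon^{-1},\quad C_E=C\,M,$$ whose transformer $f$ is moreover of the form $F_2^{\rm FF}\circ F^{\rm SA}\circ F_1^{\rm FF}$ (one self-attention layer between two feed-forward layers) with weights obeying the same bounds, such that for all $t\in[t_0,T]$ $$\sum_{x\in\mathcal S}\big\|u^i_\theta((x,t))-u^i(x,t)\big\|_2^2\;p_t(x)\;\le\;C\,\epsilon^{\frac4{M+2}}\,M^{\frac{12Md_0+25M}{M+2}}.$$ -/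

import Mathlib

open scoped ENNReal ContDiff Matrix BigOperators

noncomputable section

namespace DFM

/-! ### Hölder classes of functions of one real variable -/

/-- The Hölder norm of order `β = k + γ`, with `k = ⌊β⌋` and `γ ∈ [0, 1)`, of a function on
`Ω ⊆ ℝ`, as an extended nonnegative number (so that an infinite supremum is really infinite). -/
def holderNorm (β : ℝ) (Ω : Set ℝ) (f : ℝ → ℝ) : ℝ≥0∞ :=
  (∑ j ∈ Finset.range (⌊β⌋₊ + 1), ⨆ t ∈ Ω, ENNReal.ofReal |iteratedDerivWithin j f Ω t|) +
    ⨆ s ∈ Ω, ⨆ t ∈ Ω, ⨆ _ : s ≠ t,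
      ENNReal.ofReal
        (|iteratedDerivWithin ⌊β⌋₊ f Ω s - iteratedDerivWithin ⌊β⌋₊ f Ω t| /
          |s - t| ^ (β - (⌊β⌋₊ : ℝ)))

/-- The Hölder class of radius `K` of vector-valued functions on `Ω ⊆ ℝ`: every component is
`⌊β⌋` times differentiable on `Ω` and has Hölder norm at most `K`. -/
def HolderClass {ι : Type*} (β : ℝ) (Ω : Set ℝ) (K : ℝ) : Set (ℝ → ι → ℝ) :=
  {f | ∀ y, (∀ j < ⌊β⌋₊, DifferentiableOn ℝ (iteratedDerivWithin j (fun t => f t y) Ω) Ω) ∧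
    holderNorm β Ω (fun t => f t y) ≤ ENNReal.ofReal K}

/-! ### Mixture paths and their factorized velocities -/

/-- The state space of sequences of length `d` over a vocabulary of `M` tokens.  The element `a`
of `Fin M` stands for the token `a + 1` of `{1, …, M}`. -/
abbrev State (d M : ℕ) : Type := Fin d → Fin M

/-- The embedding of a token as the corresponding integer in `{1, …, M}`, as a real number. -/
def token {M : ℕ} (a : Fin M) : ℝ := (a : ℕ) + 1

/-- The Kronecker delta. -/
def kron {M : ℕ} (a b : Fin M) : ℝ := if a = b then 1 else 0

/-- A scheduler: a smooth function on `[0, 1]` with `κ 0 = 0`, `κ 1 = 1` and a positive derivative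
on `(0, 1)`; in particular it is strictly increasing on `[0, 1]`. -/
structure IsScheduler (κ : ℝ → ℝ) : Prop where
  smooth : ContDiffOn ℝ ∞ κ (Set.Icc 0 1)
  zero : κ 0 = 0
  one : κ 1 = 1
  deriv_pos : ∀ t ∈ Set.Ioo (0 : ℝ) 1, 0 < deriv κ t

/-- The conditional mixture path `p_{t|0,1}(x | x₀, x₁)`, a product over the coordinates. -/
def condPath {d M : ℕ} (κ : ℝ → ℝ) (t : ℝ) (x x₀ x₁ : State d M) : ℝ :=
  ∏ j, (κ t * kron (x j) (x₁ j) + (1 - κ t) * kron (x j) (x₀ j))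

/-- The marginal path `p_t(x)`, where `π` is the joint mass function of source and target. -/
def path {d M : ℕ} (κ : ℝ → ℝ) (π : State d M × State d M → ℝ) (t : ℝ) (x : State d M) : ℝ :=
  ∑ z, condPath κ t x z.1 z.2 * π z

/-- The conditional factorized velocity of coordinate `i` in state `x`, as a vector indexed by the
token `y`, given the target `x₁`. -/
def condVelocity {d M : ℕ} (κ : ℝ → ℝ) (i : Fin d) (x x₁ : State d M) (t : ℝ) (y : Fin M) : ℝ :=
  deriv κ t / (1 - κ t) * (kron y (x₁ i) - kron y (x i))

/-- The marginal factorized velocity `u^i(x, t)`: the average of the conditional velocity over the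
posterior law of source and target given `X_t = x`.  (States with `p_t(x) = 0` get the value `0`.) -/
def velocity {d M : ℕ} (κ : ℝ → ℝ) (π : State d M × State d M → ℝ) (i : Fin d)
    (x : State d M) (t : ℝ) (y : Fin M) : ℝ :=
  ∑ z, condVelocity κ i x z.2 t y * (condPath κ t x z.1 z.2 * π z / path κ π t x)

/-- The average of the conditional factorized velocity over the law of the target `x₁` (without
conditioning on the current state). -/
def averagedVelocity {d M : ℕ} (κ : ℝ → ℝ) (π : State d M × State d M → ℝ) (i : Fin d)
    (x : State d M) (t : ℝ) (y : Fin M) : ℝ :=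
  ∑ z, condVelocity κ i x z.2 t y * π z

/-! ### Matrix norms -/

/-- The spectral norm `‖A‖₂`: the operator norm for the Euclidean norms. -/
def specNorm {m n : ℕ} (A : Matrix (Fin m) (Fin n) ℝ) : ℝ :=
  ‖LinearMap.toContinuousLinearMap (Matrix.toEuclideanLin A)‖

/-- The norm `‖A‖_{2,∞}`: the largest Euclidean norm of a row. -/
def twoInfNorm {m n : ℕ} (A : Matrix (Fin m) (Fin n) ℝ) : ℝ :=
  ⨆ i, √(∑ j, A i j ^ 2)

/-- The Frobenius norm. -/
def frobNorm {m n : ℕ} (A : Matrix (Fin m) (Fin n) ℝ) : ℝ :=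
  √(∑ i, ∑ j, A i j ^ 2)

/-! ### Transformers -/

/-- Parameters of a feed-forward layer of hidden dimension `r` on `d₀`-dimensional tokens. -/
structure FFParams (r d₀ : ℕ) where
  W₁ : Matrix (Fin r) (Fin d₀) ℝ
  W₂ : Matrix (Fin d₀) (Fin r) ℝ
  b₁ : Fin r → ℝ
  b₂ : Fin d₀ → ℝ

/-- The feed-forward layer `Z ↦ Z + W₂ ReLU(W₁ Z + b₁ 1ᵀ) + b₂ 1ᵀ`. -/
def FFParams.layer {r d₀ L : ℕ} (p : FFParams r d₀) (Z : Matrix (Fin d₀) (Fin L) ℝ) :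
    Matrix (Fin d₀) (Fin L) ℝ :=
  Z + p.W₂ * (p.W₁ * Z + Matrix.of fun a _ => p.b₁ a).map (fun v => max v 0) +
    Matrix.of fun a _ => p.b₂ a

/-- Parameters of a self-attention layer with `h` heads and hidden dimension `s`. -/
structure SAParams (h s d₀ : ℕ) where
  WK : Fin h → Matrix (Fin s) (Fin d₀) ℝ
  WQ : Fin h → Matrix (Fin s) (Fin d₀) ℝ
  WV : Fin h → Matrix (Fin s) (Fin d₀) ℝ
  WO : Fin h → Matrix (Fin d₀) (Fin s) ℝ

/-- The column-wise softmax. -/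
def softmaxCol {L : ℕ} (A : Matrix (Fin L) (Fin L) ℝ) : Matrix (Fin L) (Fin L) ℝ :=
  Matrix.of fun a b => Real.exp (A a b) / ∑ c, Real.exp (A c b)

/-- The self-attention layer
`Z ↦ Z + ∑ₙ W_Oⁿ (W_Vⁿ Z) Softmax((W_Kⁿ Z)ᵀ (W_Qⁿ Z))`, summed over the heads. -/
def SAParams.layer {h s d₀ L : ℕ} (p : SAParams h s d₀) (Z : Matrix (Fin d₀) (Fin L) ℝ) :
    Matrix (Fin d₀) (Fin L) ℝ :=
  Z + ∑ n, p.WO n * (p.WV n * Z) * softmaxCol ((p.WK n * Z)ᵀ * (p.WQ n * Z))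

/-- The bounds that index a transformer class. -/
structure Bounds where
  /-- bound for the output of the transformer -/
  CT : ℝ
  /-- bound for the `(2,∞)`-norm of `W_Kᵀ W_Q` -/
  CKQinf : ℝ
  /-- bound for the spectral norm of `W_Kᵀ W_Q` -/
  CKQ : ℝ
  /-- bound for the `(2,∞)`-norm of `W_O W_V` -/
  COVinf : ℝ
  /-- bound for the spectral norm of `W_O W_V` -/
  COV : ℝ
  /-- bound for the `(2,∞)`-norm of the transposed positional encoding -/
  CE : ℝ
  /-- bound for the `(2,∞)`-norms of the feed-forward weights -/
  CFinf : ℝ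
  /-- bound for the spectral norms of the feed-forward weights -/
  CF : ℝ
  /-- Lipschitz constant of the transformer in the Frobenius norm -/
  LT : ℝ

/-- The feed-forward weights obey the bounds. -/
def FFParams.Obeys {r d₀ : ℕ} (p : FFParams r d₀) (B : Bounds) : Prop :=
  twoInfNorm p.W₁ ≤ B.CFinf ∧ twoInfNorm p.W₂ ≤ B.CFinf ∧
    specNorm p.W₁ ≤ B.CF ∧ specNorm p.W₂ ≤ B.CF

/-- The attention weights of every head obey the bounds. -/
def SAParams.Obeys {h s d₀ : ℕ} (p : SAParams h s d₀) (B : Bounds) : Prop :=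
  ∀ n, specNorm ((p.WK n)ᵀ * p.WQ n) ≤ B.CKQ ∧ twoInfNorm ((p.WK n)ᵀ * p.WQ n) ≤ B.CKQinf ∧
    specNorm (p.WO n * p.WV n) ≤ B.COV ∧ twoInfNorm (p.WO n * p.WV n) ≤ B.COVinf

/-- The map of a list of transformer blocks (each one a feed-forward layer after a self-attention
layer); the head of the list is applied last. -/
def blocksMap {h s r d₀ L : ℕ} :
    List (SAParams h s d₀ × FFParams r d₀) → Matrix (Fin d₀) (Fin L) ℝ → Matrix (Fin d₀) (Fin L) ℝ
  | [] => id
  | b :: bs => fun Z => b.2.layer (b.1.layer (blocksMap bs Z))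

/-- The transformer network class with parameter bounds: compositions of one or more transformer
blocks whose weights obey the bounds, with bounded output and Lipschitz for the Frobenius norm. -/
def TransformerClass (h s r d₀ L : ℕ) (B : Bounds) :
    Set (Matrix (Fin d₀) (Fin L) ℝ → Matrix (Fin d₀) (Fin L) ℝ) :=
  {f | (∃ bs : List (SAParams h s d₀ × FFParams r d₀), bs ≠ [] ∧
      (∀ b ∈ bs, b.1.Obeys B ∧ b.2.Obeys B) ∧ f = blocksMap bs) ∧
    (∀ Z, frobNorm (f Z) ≤ B.CT) ∧
    ∀ Z₁ Z₂, frobNorm (f Z₁ - f Z₂) ≤ B.LT * frobNorm (Z₁ - Z₂)}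

/-- The maps `F₂^FF ∘ F^SA ∘ F₁^FF` with a single self-attention layer between two feed-forward
layers, all weights obeying the bounds. -/
def OneAttentionClass (h s r d₀ L : ℕ) (B : Bounds) :
    Set (Matrix (Fin d₀) (Fin L) ℝ → Matrix (Fin d₀) (Fin L) ℝ) :=
  {f | ∃ (p₁ : FFParams r d₀) (q : SAParams h s d₀) (p₂ : FFParams r d₀),
    p₁.Obeys B ∧ q.Obeys B ∧ p₂.Obeys B ∧ f = fun Z => p₂.layer (q.layer (p₁.layer Z))}

/-! ### Reshape layers -/

/-- The reshape layer `R₁`.  The vector of length `d + 1` is cut into consecutive columns of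
length `d₀`, and the resulting `d₀ × (d + 1)/d₀` matrix is repeated along the columns.  (It is used
when `d₀ ∣ d + 1` and `d + 1 ∣ L * d₀`; `Fin.ofNat (d + 1)` reduces modulo `d + 1`.) -/
def reshapeIn {d : ℕ} (d₀ L : ℕ) (v : Fin (d + 1) → ℝ) : Matrix (Fin d₀) (Fin L) ℝ :=
  Matrix.of fun a b => v (Fin.ofNat (d + 1) ((b : ℕ) * d₀ + (a : ℕ)))

/-- The reshape layer `R₂`: the columns of a `d₀ × L` matrix, one after the other, as a vector of
length `M = L * d₀`. -/
def reshapeOut {M d₀ L : ℕ} (hM : M = L * d₀) (Z : Matrix (Fin d₀) (Fin L) ℝ) (y : Fin M) : ℝ :=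
  Z (Fin.cast hM y).modNat (Fin.cast hM y).divNat

/-- The embedded input `(E(x), t)` in `ℝ^{d+1}`. -/
def embed {d M : ℕ} (x : State d M) (t : ℝ) : Fin (d + 1) → ℝ :=
  Fin.snoc (α := fun _ => ℝ) (fun j => token (x j)) t

/-- The class of networks `R₂ ∘ f ∘ F^E ∘ R₁`, where `F^E(Z) = Z + E` is the positional encoding,
with `‖Eᵀ‖_{2,∞} ≤ C_E`, and where `f` is a transformer that obeys the bounds and consists of one
self-attention layer between two feed-forward layers. -/
def ReshapedClass (h s r d : ℕ) {M d₀ L : ℕ} (hM : M = L * d₀) (B : Bounds) :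
    Set ((Fin (d + 1) → ℝ) → Fin M → ℝ) :=
  {u | ∃ f ∈ TransformerClass h s r d₀ L B ∩ OneAttentionClass h s r d₀ L B,
    ∃ E : Matrix (Fin d₀) (Fin L) ℝ, twoInfNorm Eᵀ ≤ B.CE ∧
      u = fun v => reshapeOut hM (f (reshapeIn d₀ L v + E))}

end DFM

end

/-!
The weights of a single attention head are bounded, but the number of heads is not, so that the
attention layer as a whole can amplify by any factor; the numbers of neurons are not bounded either.
Therefore the network is a universal approximator for functions of state and time that are
continuous in time, as long as the feed-forward bounds leave room for cancelling the residual
connections, the key-query bounds for a matrix of ones and the encoding bound for telling the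
entries apart.  The Hölder hypothesis enters only through continuity in time, and any positive
number can be prescribed as the error.

*First feed-forward layer.*  It acts entrywise, by `lam * (code + ν * timeTent)`, where `code` gives
the position and the token of an entry (`code_entry`) and `timeTent` the time at one single entry
(`timeTent_entry`).  The factor `lam` is so small that the bounds for the weights hold.

*Attention layer.*  Heads with uniform attention give the sum of all entries, which determines the
state `x` by uniqueness of base `M` digits (`sum_codeValue_injective`).  Heads with score `ζ c * ζ b`,
where `ζ` are the column sums, give a softmax mean that is strictly increasing in `ζ b`
(`softMean_lt_softMean`) and thus determines the column `b`.  A linear combination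
`ρ(b, x, t) = S * (N x + ν * t) + D b x (ν * t)` is injective for large `S` and then small `ν`
(`exists_separating`).  By using many heads, any multiple `Q * ρ` is added to the first entry of
column `b` (`exists_saParams`); for large `Q` the residual connection is negligible.

*Second feed-forward layer.*  By Tietze's theorem the wanted value is a continuous function of `ρ`
(`exists_continuous_comp_eq`), which is approximated by piecewise linear functions
(`exists_mem_rampSpan_approx`).  As its input is `Q * ρ`, the weights are small for large `Q`
(`IsReluNet.comp_inv_mul`).

The composition is bounded and Lipschitz, since both feed-forward layers compute bounded Lipschitz
functions and the attention layer is Lipschitz on bounded sets (`exists_bound_and_lipschitz`).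
-/

namespace DFM

/-! ### Sums of ramps -/

/-- The unit ramp: the identity clipped to `[0, 1]`. -/
noncomputable def ramp (z : ℝ) : ℝ := max z 0 - max (z - 1) 0

lemma ramp_of_nonpos {z : ℝ} (h : z ≤ 0) : ramp z = 0 := by
  rw [ramp, max_eq_right h, max_eq_right (by linarith), sub_zero]

lemma ramp_of_one_le {z : ℝ} (h : 1 ≤ z) : ramp z = 1 := by
  rw [ramp, max_eq_left (by linarith), max_eq_left (by linarith)]; ring

lemma ramp_of_mem {z : ℝ} (h0 : 0 ≤ z) (h1 : z ≤ 1) : ramp z = z := by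
  rw [ramp, max_eq_left h0, max_eq_right (by linarith), sub_zero]

lemma ramp_eq (z : ℝ) : ramp z = max 0 (min z 1) := by
  rcases le_total z 0 with h | h
  · rw [ramp_of_nonpos h, max_eq_left ((min_le_left _ _).trans h)]
  rcases le_total z 1 with h' | h'
  · rw [ramp_of_mem h h', min_eq_left h', max_eq_right h]
  · rw [ramp_of_one_le h', min_eq_right h', max_eq_right zero_le_one]

lemma ramp_nonneg (z : ℝ) : 0 ≤ ramp z := by rw [ramp_eq]; exact le_max_left _ _

lemma ramp_le_one (z : ℝ) : ramp z ≤ 1 := by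
  rw [ramp_eq]; exact max_le zero_le_one (min_le_right _ _)

lemma lipschitzWith_ramp : LipschitzWith 1 ramp := by
  rw [show ramp = fun z => max 0 (min z 1) from funext ramp_eq]
  exact (LipschitzWith.id.min_const 1).const_max 0

/-- On integers, the difference of two consecutive ramps detects zero. -/
lemma ramp_int_succ_sub (n : ℤ) : ramp ((n : ℝ) + 1) - ramp n = if n = 0 then 1 else 0 := by
  rcases lt_trichotomy n 0 with h | h | h
  · have : (n : ℝ) + 1 ≤ 0 := by exact_mod_cast h
    rw [ramp_of_nonpos this, ramp_of_nonpos (by linarith), if_neg h.ne, sub_zero]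
  · subst h; rw [ramp_of_one_le (by simp), ramp_of_nonpos (by simp)]; simp
  · have : (1 : ℝ) ≤ n := by exact_mod_cast h
    rw [ramp_of_one_le this, ramp_of_one_le (by linarith), if_neg h.ne', sub_self]

/-- The linear span of the affine reparametrizations of the unit ramp: the bounded continuous
piecewise linear functions of one variable that a feed-forward layer can compute. -/
noncomputable def rampSpan : Submodule ℝ (ℝ → ℝ) :=
  Submodule.span ℝ (Set.range fun p : ℝ × ℝ => fun z => ramp (p.1 * z + p.2))

lemma ramp_mem_rampSpan (a b : ℝ) : (fun z => ramp (a * z + b)) ∈ rampSpan :=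
  Submodule.subset_span ⟨(a, b), rfl⟩

lemma const_mem_rampSpan (c : ℝ) : (fun _ => c) ∈ rampSpan := by
  convert rampSpan.smul_mem c (ramp_mem_rampSpan 0 1) using 1
  funext z
  simp [ramp]

lemma bounded_and_lipschitz_of_mem_rampSpan {f : ℝ → ℝ} (hf : f ∈ rampSpan) :
    (∃ C, ∀ z, |f z| ≤ C) ∧ ∃ K, LipschitzWith K f := by
  induction hf using Submodule.span_induction with
  | mem f h =>
    obtain ⟨⟨a, b⟩, rfl⟩ := h
    refine ⟨⟨1, fun z => abs_le.2 ⟨by linarith [ramp_nonneg (a * z + b)], ramp_le_one _⟩⟩,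
      ‖a‖₊, LipschitzWith.of_dist_le_mul fun x y => ?_⟩
    have := lipschitzWith_ramp.dist_le_mul (a * x + b) (a * y + b)
    simp only [NNReal.coe_one, one_mul] at this
    refine this.trans_eq ?_
    rw [Real.dist_eq, Real.dist_eq, coe_nnnorm, Real.norm_eq_abs, ← abs_mul]
    ring_nf
  | zero => exact ⟨⟨0, by simp⟩, 0, LipschitzWith.const 0⟩
  | add f g _ _ hf hg =>
    obtain ⟨⟨C, hC⟩, K, hK⟩ := hf
    obtain ⟨⟨C', hC'⟩, K', hK'⟩ := hg
    exact ⟨⟨C + C', fun z => (abs_add_le _ _).trans (add_le_add (hC z) (hC' z))⟩, _, hK.add hK'⟩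
  | smul a f _ hf =>
    obtain ⟨⟨C, hC⟩, K, hK⟩ := hf
    refine ⟨⟨|a| * C, fun z => ?_⟩, ‖a‖₊ * K, LipschitzWith.of_dist_le_mul fun x y => ?_⟩
    · rw [Pi.smul_apply, smul_eq_mul, abs_mul]
      exact mul_le_mul_of_nonneg_left (hC z) (abs_nonneg a)
    · have := hK.dist_le_mul x y
      rw [Pi.smul_apply, Pi.smul_apply, dist_smul₀, NNReal.coe_mul, mul_assoc, coe_nnnorm]
      exact mul_le_mul_of_nonneg_left this (norm_nonneg a)

/-- Sums of ramps are dense among the continuous functions on a bounded interval, by piecewise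
linear interpolation on a fine grid. -/
lemma exists_mem_rampSpan_approx {g : ℝ → ℝ} (hg : Continuous g) (R : ℝ) {η : ℝ} (hη : 0 < η) :
    ∃ f ∈ rampSpan, ∀ z ∈ Set.Icc (-R) R, |f z - g z| ≤ η := by
  have huc := isCompact_Icc.uniformContinuousOn_of_continuous
    (hg.continuousOn (s := Set.Icc (-R) (R + 1)))
  obtain ⟨δ', hδ', hmod⟩ := Metric.uniformContinuousOn_iff.1 huc η hη
  obtain ⟨δ, hδ, hδδ', hδ1⟩ : ∃ δ : ℝ, 0 < δ ∧ δ < δ' ∧ δ ≤ 1 :=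
    ⟨min (δ' / 2) 1, by positivity, (min_le_left _ _).trans_lt (by linarith), min_le_right _ _⟩
  -- the interpolant on the first `m` cells, extended by a constant
  have key : ∀ m : ℕ, -R + m * δ ≤ R + δ → ∃ f ∈ rampSpan,
      (∀ z ∈ Set.Icc (-R) (-R + m * δ), |f z - g z| ≤ η) ∧
        ∀ z, -R + m * δ ≤ z → f z = g (-R + m * δ) := by
    intro m
    induction m with
    | zero =>
      intro _
      refine ⟨fun _ => g (-R), const_mem_rampSpan _, fun z hz => ?_, fun z _ => by simp⟩
      have : z = -R := le_antisymm (by simpa using hz.2) hz.1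
      simp [this, hη.le]
    | succ m ih =>
      intro hm
      push_cast at hm ⊢
      obtain ⟨f, hf, hf1, hf2⟩ := ih (by linarith)
      set a := -R + m * δ with ha
      have ha' : -R + ((m : ℝ) + 1) * δ = a + δ := by rw [ha]; ring
      rw [ha'] at hm ⊢
      have haR : -R ≤ a := by rw [ha]; nlinarith [(Nat.cast_nonneg m : (0 : ℝ) ≤ m)]
      refine ⟨f + (g (a + δ) - g a) • fun z => ramp (δ⁻¹ * z + -(δ⁻¹ * a)),
        rampSpan.add_mem hf (rampSpan.smul_mem _ (ramp_mem_rampSpan _ _)), fun z hz => ?_,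
        fun z hz => ?_⟩
      · have harg : δ⁻¹ * z + -(δ⁻¹ * a) = δ⁻¹ * (z - a) := by ring
        simp only [Pi.add_apply, Pi.smul_apply, smul_eq_mul, harg]
        rcases le_total z a with hza | hza
        · rw [ramp_of_nonpos (mul_nonpos_of_nonneg_of_nonpos (by positivity) (by linarith))]
          simpa using hf1 z ⟨hz.1, hza⟩
        · rw [hf2 z hza]
          have hmem : ∀ w ∈ Set.Icc a (a + δ), |g w - g z| ≤ η := fun w hw => by
            have hd : dist w z < δ' := by
              rw [Real.dist_eq, abs_lt]; constructor <;> linarith [hw.1, hw.2, hz.2]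
            have := hmod w ⟨by linarith [hw.1], by linarith [hw.2]⟩ z
              ⟨hz.1, by linarith [hz.2]⟩ hd
            exact this.le
          have h1 := hmem a ⟨le_rfl, by linarith⟩
          have h2 := hmem (a + δ) ⟨by linarith, le_rfl⟩
          generalize hs : ramp (δ⁻¹ * (z - a)) = s
          have hs0 : 0 ≤ s := hs ▸ ramp_nonneg _
          have hs1 : s ≤ 1 := hs ▸ ramp_le_one _
          rw [abs_le] at h1 h2 ⊢
          constructor <;> nlinarith
      · have harg : δ⁻¹ * z + -(δ⁻¹ * a) = δ⁻¹ * (z - a) := by ring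
        simp only [Pi.add_apply, Pi.smul_apply, smul_eq_mul, harg]
        have h1 : (1 : ℝ) ≤ δ⁻¹ * (z - a) := by
          rw [inv_mul_eq_div, le_div_iff₀ hδ]; linarith
        rw [hf2 z (by linarith), ramp_of_one_le h1]; ring
  rcases lt_or_ge R 0 with hR | hR
  · exact ⟨0, rampSpan.zero_mem, fun z hz => absurd (hz.1.trans hz.2) (by linarith)⟩
  obtain ⟨f, hf, hf1, -⟩ := key ⌈2 * R / δ⌉₊ (by
    have := Nat.ceil_lt_add_one (show 0 ≤ 2 * R / δ by positivity)
    have h2 : (⌈2 * R / δ⌉₊ : ℝ) * δ ≤ (2 * R / δ + 1) * δ :=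
      mul_le_mul_of_nonneg_right this.le hδ.le
    rw [add_mul, div_mul_cancel₀ _ hδ.ne'] at h2
    linarith)
  refine ⟨f, hf, fun z hz => hf1 z ⟨hz.1, hz.2.trans ?_⟩⟩
  have := Nat.le_ceil (2 * R / δ)
  rw [div_le_iff₀ hδ] at this
  linarith

/-! ### Matrix norms and bounds -/

lemma frobNorm_nonneg {m n : ℕ} (A : Matrix (Fin m) (Fin n) ℝ) : 0 ≤ frobNorm A :=
  Real.sqrt_nonneg _

lemma frobNorm_le {m n : ℕ} {A : Matrix (Fin m) (Fin n) ℝ} {C : ℝ} (hC : 0 ≤ C)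
    (h : ∑ i, ∑ j, A i j ^ 2 ≤ C ^ 2) : frobNorm A ≤ C :=
  Real.sqrt_le_iff.2 ⟨hC, h⟩

lemma twoInfNorm_le_frobNorm {m n : ℕ} (A : Matrix (Fin m) (Fin n) ℝ) :
    twoInfNorm A ≤ frobNorm A :=
  Real.iSup_le (fun i => Real.sqrt_le_sqrt
    (Finset.single_le_sum (f := fun i => ∑ j, A i j ^ 2)
      (fun _ _ => Finset.sum_nonneg fun _ _ => sq_nonneg _) (Finset.mem_univ i)))
    (frobNorm_nonneg A)

lemma specNorm_le_frobNorm {m n : ℕ} (A : Matrix (Fin m) (Fin n) ℝ) :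
    specNorm A ≤ frobNorm A := by
  refine ContinuousLinearMap.opNorm_le_bound _ (frobNorm_nonneg A) fun v => ?_
  have hs : 0 ≤ ∑ i, ∑ j, A i j ^ 2 :=
    Finset.sum_nonneg fun _ _ => Finset.sum_nonneg fun _ _ => sq_nonneg _
  rw [LinearMap.coe_toContinuousLinearMap', EuclideanSpace.norm_eq, EuclideanSpace.norm_eq,
    frobNorm, ← Real.sqrt_mul hs, Finset.sum_mul]
  refine Real.sqrt_le_sqrt (Finset.sum_le_sum fun i _ => ?_)
  simp only [Real.norm_eq_abs, sq_abs]
  exact Finset.sum_mul_sq_le_sq_mul_sq Finset.univ (A i) v.ofLp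

lemma frobNorm_zero {m n : ℕ} : frobNorm (0 : Matrix (Fin m) (Fin n) ℝ) = 0 := by
  simp [frobNorm]

/-! ### Shallow networks and feed-forward layers -/

/-- `IsReluNet n C g` says that `g : ℝᵐ → ℝᵐ` is computed by `n` ReLU neurons whose inner and whose
outer weights both have sum of squares at most `C`.  There is no outer bias, since a neuron
with zero inner weight is constant. -/
def IsReluNet {m : ℕ} (n : ℕ) (C : ℝ) (g : (Fin m → ℝ) → Fin m → ℝ) : Prop :=
  ∃ (w c : Fin n → Fin m → ℝ) (β : Fin n → ℝ),
    (∀ z j, g z j = ∑ k, c k j * max ((∑ i, w k i * z i) + β k) 0) ∧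
      ∑ k, ∑ i, w k i ^ 2 ≤ C ∧ ∑ k, ∑ i, c k i ^ 2 ≤ C

namespace IsReluNet

variable {m n n' : ℕ} {C C' : ℝ} {g g' : (Fin m → ℝ) → Fin m → ℝ}

lemma mono (h : IsReluNet n C g) (hC : C ≤ C') : IsReluNet n C' g := by
  obtain ⟨w, c, β, h1, h2, h3⟩ := h
  exact ⟨w, c, β, h1, h2.trans hC, h3.trans hC⟩

lemma zero (n : ℕ) : IsReluNet n 0 (0 : (Fin m → ℝ) → Fin m → ℝ) :=
  ⟨0, 0, 0, by simp, by simp, by simp⟩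

lemma neuron (w c : Fin m → ℝ) (β : ℝ) :
    ∃ C, IsReluNet 1 C fun z j => c j * max ((∑ i, w i * z i) + β) 0 :=
  ⟨max (∑ i, w i ^ 2) (∑ i, c i ^ 2), fun _ => w, fun _ => c, fun _ => β, by simp, by simp, by simp⟩

lemma add (h : IsReluNet n C g) (h' : IsReluNet n' C' g') : IsReluNet (n + n') (C + C') (g + g') := by
  obtain ⟨w, c, β, h1, h2, h3⟩ := h
  obtain ⟨w', c', β', h1', h2', h3'⟩ := h'
  refine ⟨Fin.append w w', Fin.append c c', Fin.append β β', fun z j => ?_, ?_, ?_⟩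
  · rw [Fin.sum_univ_add, Pi.add_apply, Pi.add_apply, h1, h1']
    simp only [Fin.append_left, Fin.append_right]
  · rw [Fin.sum_univ_add]
    simpa only [Fin.append_left, Fin.append_right] using add_le_add h2 h2'
  · rw [Fin.sum_univ_add]
    simpa only [Fin.append_left, Fin.append_right] using add_le_add h3 h3'

lemma pad (h : IsReluNet n C g) (hn : n ≤ n') : IsReluNet n' C g := by
  obtain ⟨k, rfl⟩ := Nat.exists_eq_add_of_le hn
  simpa using h.add (zero k)

/-- Scaling the output by a nonnegative factor scales the cost by the same factor, because the
factor can be shared between the inner and the outer weights. -/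
lemma smul_of_nonneg (h : IsReluNet n C g) {a : ℝ} (ha : 0 ≤ a) : IsReluNet n (a * C) (a • g) := by
  obtain ⟨w, c, β, h1, h2, h3⟩ := h
  have hs : √a * √a = a := Real.mul_self_sqrt ha
  refine ⟨fun k i => √a * w k i, fun k i => √a * c k i, fun k => √a * β k, fun z j => ?_, ?_, ?_⟩
  · rw [Pi.smul_apply, Pi.smul_apply, h1, smul_eq_mul, Finset.mul_sum]
    refine Finset.sum_congr rfl fun k _ => ?_
    have : (∑ i, √a * w k i * z i) + √a * β k = √a * ((∑ i, w k i * z i) + β k) := by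
      rw [mul_add, Finset.mul_sum]; simp only [mul_assoc]
    rw [this, ← mul_zero (√a), ← mul_max_of_nonneg _ _ (Real.sqrt_nonneg a), mul_zero]
    nth_rw 1 [← hs]
    ring
  · simpa only [mul_pow, Real.sq_sqrt ha, ← Finset.mul_sum] using mul_le_mul_of_nonneg_left h2 ha
  · simpa only [mul_pow, Real.sq_sqrt ha, ← Finset.mul_sum] using mul_le_mul_of_nonneg_left h3 ha

/-- Scaling the output by a factor of modulus at most one does not increase the cost. -/
lemma smul_of_abs_le_one (h : IsReluNet n C g) {a : ℝ} (ha : |a| ≤ 1) :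
    IsReluNet n C (a • g) := by
  obtain ⟨w, c, β, h1, h2, h3⟩ := h
  refine ⟨w, fun k i => a * c k i, β, fun z j => ?_, h2, le_trans ?_ h3⟩
  · rw [Pi.smul_apply, Pi.smul_apply, h1, smul_eq_mul, Finset.mul_sum]
    simp only [mul_assoc]
  · refine Finset.sum_le_sum fun k _ => Finset.sum_le_sum fun i _ => ?_
    rw [mul_pow]
    exact mul_le_of_le_one_left (sq_nonneg _) ((sq_le_one_iff_abs_le_one a).2 ha)

lemma smul (h : IsReluNet n C g) (a : ℝ) : ∃ C', IsReluNet n C' (a • g) := by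
  have := (h.smul_of_abs_le_one (a := SignType.sign a) (by
    rcases lt_trichotomy a 0 with h | h | h <;> simp [h])).smul_of_nonneg (abs_nonneg a)
  rw [smul_smul, abs_mul_sign] at this
  exact ⟨_, this⟩

/-- Precomposition with a contraction by the factor `Q` lowers the cost by the factor `Q`. -/
lemma comp_inv_mul (h : IsReluNet n C g) {Q : ℝ} (hQ : 0 < Q) :
    IsReluNet n (Q⁻¹ * C) fun z => g fun i => Q⁻¹ * z i := by
  obtain ⟨w, c, β, h1, h2, h3⟩ := h
  -- before the common rescaling of inner and outer weights, the function is `Q⁻¹` times a network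
  -- with biases multiplied by `Q`
  have : IsReluNet n C fun z => Q • g fun i => Q⁻¹ * z i := by
    refine ⟨w, c, fun k => Q * β k, fun z j => ?_, h2, h3⟩
    change Q * g (fun i => Q⁻¹ * z i) j = _
    rw [h1, Finset.mul_sum]
    refine Finset.sum_congr rfl fun k _ => ?_
    have : (∑ i, w k i * z i) + Q * β k = Q * ((∑ i, w k i * (Q⁻¹ * z i)) + β k) := by
      rw [mul_add, Finset.mul_sum]
      congr 1
      refine Finset.sum_congr rfl fun i _ => ?_
      field_simp
    rw [this, ← mul_zero Q, ← mul_max_of_nonneg _ _ hQ.le, mul_zero]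
    ring
  convert this.smul_of_nonneg (inv_nonneg.2 hQ.le) using 1
  funext z
  simp [smul_smul, inv_mul_cancel₀ hQ.ne']

lemma exists_sum {ι : Type*} (s : Finset ι) {G : ι → (Fin m → ℝ) → Fin m → ℝ}
    (h : ∀ a ∈ s, ∃ n C, IsReluNet n C (G a)) : ∃ n C, IsReluNet n C (∑ a ∈ s, G a) := by
  refine Finset.sum_induction G (fun g => ∃ n C, IsReluNet n C g) ?_ ⟨0, 0, zero 0⟩ h
  rintro g g' ⟨n, C, h⟩ ⟨n', C', h'⟩
  exact ⟨_, _, h.add h'⟩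

/-- A sum of ramps of one coordinate, written into one coordinate. -/
lemma exists_of_mem_rampSpan_single {f : ℝ → ℝ} (hf : f ∈ rampSpan) (i j : Fin m) :
    ∃ n C, IsReluNet n C fun z => Pi.single j (f (z i)) := by
  induction hf using Submodule.span_induction with
  | mem f h =>
    obtain ⟨⟨a, b⟩, rfl⟩ := h
    obtain ⟨C, hC⟩ := neuron (m := m) (Pi.single i a) (Pi.single j 1) b
    obtain ⟨C', hC'⟩ := neuron (m := m) (Pi.single i a) (Pi.single j (-1)) (b - 1)
    refine ⟨_, _, cast (congrArg _ ?_) (hC.add hC')⟩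
    funext z l
    have : ∑ l, (Pi.single i a : Fin m → ℝ) l * z l = a * z i := by
      simp [Pi.single_apply]
    simp only [Pi.add_apply, this]
    simp only [Pi.single_apply, ramp]
    split_ifs <;> ring_nf
  | zero => exact ⟨0, 0, by convert zero (m := m) 0; simp⟩
  | add f f' _ _ hf hf' =>
    obtain ⟨n, C, h⟩ := hf
    obtain ⟨n', C', h'⟩ := hf'
    refine ⟨_, _, cast (congrArg _ ?_) (h.add h')⟩
    funext z
    simp [Pi.single_add]
  | smul a f _ hf =>
    obtain ⟨n, C, h⟩ := hf
    obtain ⟨C', h'⟩ := h.smul a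
    refine ⟨_, _, cast (congrArg _ ?_) h'⟩
    funext z l
    simp [Pi.single_apply]

/-- A vector whose entries are sums of ramps of single coordinates. -/
lemma exists_of_mem_rampSpan {f : Fin m → ℝ → ℝ} (hf : ∀ j, f j ∈ rampSpan) (i : Fin m → Fin m) :
    ∃ n C, IsReluNet n C fun z j => f j (z (i j)) := by
  obtain ⟨n, C, h⟩ := exists_sum Finset.univ fun j _ => exists_of_mem_rampSpan_single (hf j) (i j) j
  refine ⟨n, C, cast (congrArg _ ?_) h⟩
  funext z
  rw [Finset.sum_apply]
  exact Finset.univ_sum_single fun j => f j (z (i j))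

/-- The residual connection of a feed-forward layer can be cancelled at a fixed cost. -/
lemma neg_id : IsReluNet (m + m) (2 * m) fun z : Fin m → ℝ => -z := by
  refine ⟨Fin.append (fun k => Pi.single k 1) fun k => Pi.single k (-1),
    Fin.append (fun k => Pi.single k (-1)) fun k => Pi.single k 1, 0, fun z j => ?_, ?_, ?_⟩
  · rw [Fin.sum_univ_add]
    simp only [Fin.append_left, Fin.append_right, Pi.zero_apply, add_zero, Pi.single_apply,
      ite_mul, one_mul, zero_mul, Finset.sum_ite_eq', Finset.sum_ite_eq, Finset.mem_univ, if_true,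
      Pi.neg_apply, neg_mul]
    rcases le_total (z j) 0 with h | h
    · rw [max_eq_right h, max_eq_left (by linarith)]; ring
    · rw [max_eq_left h, max_eq_right (by linarith)]; ring
  all_goals
    rw [Fin.sum_univ_add]
    simp only [Fin.append_left, Fin.append_right, Pi.single_apply, ite_pow, one_pow, neg_sq]
    simp
    linarith

end IsReluNet

/-- A shallow network of cost at most one is computed columnwise by a feed-forward layer, whose
weights have Frobenius norm at most `√(2 d₀ + 1)`. -/
lemma exists_ffParams {d₀ n : ℕ} {g : (Fin d₀ → ℝ) → Fin d₀ → ℝ} (hg : IsReluNet n 1 g) {r : ℕ}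
    (hr : n + (d₀ + d₀) ≤ r) : ∃ p : FFParams r d₀,
      frobNorm p.W₁ ≤ √(2 * d₀ + 1) ∧ frobNorm p.W₂ ≤ √(2 * d₀ + 1) ∧
      ∀ (L : ℕ) (Z : Matrix (Fin d₀) (Fin L) ℝ) (a : Fin d₀) (b : Fin L),
        p.layer Z a b = g (fun j => Z j b) a := by
  obtain ⟨w, c, β, h1, h2, h3⟩ := (hg.add IsReluNet.neg_id).pad hr
  refine ⟨⟨Matrix.of w, Matrix.of fun j k => c k j, β, 0⟩, Real.sqrt_le_sqrt ?_,
    Real.sqrt_le_sqrt ?_, fun L Z a b => ?_⟩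
  · simpa [add_comm] using h2
  · rw [Finset.sum_comm]
    simpa [add_comm] using h3
  · have := h1 (fun j => Z j b) a
    simp only [Pi.add_apply, Pi.neg_apply] at this
    simp only [FFParams.layer, Matrix.add_apply, Matrix.mul_apply, Matrix.of_apply,
      Matrix.map_apply, Pi.zero_apply, add_zero]
    linarith

/-! ### Self-attention layers -/

/-- The mean of the numbers `ζ c` under the softmax weights with scores `ζ c * ζ b`. -/
noncomputable def softMean {L : ℕ} (ζ : Fin L → ℝ) (b : Fin L) : ℝ :=
  (∑ c, ζ c * Real.exp (ζ c * ζ b)) / ∑ c, Real.exp (ζ c * ζ b)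

lemma SAParams.layer_apply {h s d₀ L : ℕ} (q : SAParams h s d₀) (Z : Matrix (Fin d₀) (Fin L) ℝ)
    (a : Fin d₀) (b : Fin L) : q.layer Z a b = Z a b +
      ∑ n, ∑ c, (∑ l, q.WO n a l * ∑ j, q.WV n l j * Z j c) *
        (Real.exp (∑ l, (∑ j, q.WK n l j * Z j c) * ∑ j, q.WQ n l j * Z j b) /
          ∑ c', Real.exp (∑ l, (∑ j, q.WK n l j * Z j c') * ∑ j, q.WQ n l j * Z j b)) := by
  simp only [SAParams.layer, Matrix.add_apply, Matrix.sum_apply]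
  rfl

lemma sum_exp_pos {L : ℕ} (f : Fin L → ℝ) (b : Fin L) : 0 < ∑ c, Real.exp (f c) :=
  Finset.sum_pos (fun _ _ => Real.exp_pos _) ⟨b, Finset.mem_univ b⟩

/-- The softmax mean is strictly increasing in the query: symmetrizing the difference of the two
means (with cleared denominators) over pairs of columns makes every term nonnegative. -/
lemma softMean_lt_softMean {L : ℕ} {ζ : Fin L → ℝ} {b b' : Fin L} (h : ζ b < ζ b') :
    softMean ζ b < softMean ζ b' := by
  rw [softMean, softMean, div_lt_div_iff₀ (sum_exp_pos _ b) (sum_exp_pos _ b), ← sub_pos,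
    Finset.sum_mul_sum, Finset.sum_mul_sum]
  set e : Fin L → Fin L → ℝ := fun c a => Real.exp (ζ c * ζ b' + ζ a * ζ b) with he
  have hsum : (∑ c, ∑ a, ζ c * Real.exp (ζ c * ζ b') * Real.exp (ζ a * ζ b)) -
      ∑ c, ∑ a, ζ c * Real.exp (ζ c * ζ b) * Real.exp (ζ a * ζ b') =
      (∑ c, ∑ a, (ζ c - ζ a) * (e c a - e a c)) / 2 := by
    have h1 : ∑ c, ∑ a, ζ c * Real.exp (ζ c * ζ b') * Real.exp (ζ a * ζ b) =
        ∑ c, ∑ a, ζ c * e c a := by simp only [he, mul_assoc, ← Real.exp_add]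
    have h2 : ∑ c, ∑ a, ζ c * Real.exp (ζ c * ζ b) * Real.exp (ζ a * ζ b') =
        ∑ c, ∑ a, ζ c * e a c := by
      simp only [he, mul_assoc, ← Real.exp_add, add_comm]
    have h3 : ∑ c, ∑ a, ζ a * e c a = ∑ c, ∑ a, ζ c * e a c := Finset.sum_comm
    have h4 : ∑ c, ∑ a, ζ a * e a c = ∑ c, ∑ a, ζ c * e c a := Finset.sum_comm
    have h5 : ∑ c, ∑ a, (ζ c - ζ a) * (e c a - e a c) = (∑ c, ∑ a, ζ c * e c a) -
        (∑ c, ∑ a, ζ c * e a c) - (∑ c, ∑ a, ζ a * e c a) + ∑ c, ∑ a, ζ a * e a c := by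
      simp only [← Finset.sum_sub_distrib, ← Finset.sum_add_distrib]
      exact Finset.sum_congr rfl fun c _ => Finset.sum_congr rfl fun a _ => by ring
    rw [h1, h2, h5, h3, h4]; ring
  rw [hsum]
  have hterm : ∀ c a, 0 ≤ (ζ c - ζ a) * (e c a - e a c) := fun c a => by
    rcases le_total (ζ c) (ζ a) with hc | hc
    · refine mul_nonneg_of_nonpos_of_nonpos (by linarith) (sub_nonpos.2 (Real.exp_le_exp.2 ?_))
      nlinarith
    · refine mul_nonneg (by linarith) (sub_nonneg.2 (Real.exp_le_exp.2 ?_))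
      nlinarith
  have hpos : 0 < (ζ b' - ζ b) * (e b' b - e b b') := by
    refine mul_pos (by linarith) (sub_pos.2 (Real.exp_lt_exp.2 ?_))
    nlinarith [sq_nonneg (ζ b' - ζ b), sq_pos_of_pos (sub_pos.2 h)]
  refine half_pos (Finset.sum_pos' (fun c _ => Finset.sum_nonneg fun a _ => hterm c a)
    ⟨b', Finset.mem_univ _, Finset.sum_pos' (fun a _ => hterm b' a) ⟨b, Finset.mem_univ _, hpos⟩⟩)

lemma contDiff_softMean {L : ℕ} {ζ : ℝ → Fin L → ℝ} (hζ : ∀ c, ContDiff ℝ 1 fun s => ζ s c)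
    (b : Fin L) : ContDiff ℝ 1 fun s => softMean (ζ s) b :=
  (ContDiff.sum fun c _ => (hζ c).mul ((hζ c).mul (hζ b)).exp).div
    (ContDiff.sum fun c _ => ((hζ c).mul (hζ b)).exp) fun _ => (sum_exp_pos _ b).ne'

/-- Attention heads of hidden dimension one can add to the first row of `Z` any linear
combination of the sum of the column sums of `Z` (from heads with uniform attention) and of their
softmax means.  The individual heads are as small as desired, as their number is not limited. -/
lemma exists_saParams {d₀ L : ℕ} (hd₀ : 0 < d₀) (A B : ℝ) {δ : ℝ} (hδ : 0 < δ) :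
    ∃ (h : ℕ) (q : SAParams h 1 d₀), 0 < h ∧
      (∀ n, frobNorm ((q.WK n)ᵀ * q.WQ n) ≤ d₀ ∧ frobNorm (q.WO n * q.WV n) ≤ δ) ∧
      ∀ (Z : Matrix (Fin d₀) (Fin L) ℝ) (a : Fin d₀) (b : Fin L), q.layer Z a b =
        Z a b + if a = ⟨0, hd₀⟩ then
          A * ∑ c, ∑ j, Z j c + B * softMean (fun c => ∑ j, Z j c) b else 0 := by
  obtain ⟨n, hn⟩ := exists_nat_gt (max (d₀ * |A * L| / δ) (d₀ * |B| / δ))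
  have hn0 : (0 : ℝ) < n := lt_of_le_of_lt (by positivity) hn
  have hn0' : 0 < n := Nat.cast_pos.1 hn0
  have hcoef : ∀ x : ℝ, d₀ * |x| / δ < n → frobNorm
      ((Matrix.of fun a (_ : Fin 1) => if a = ⟨0, hd₀⟩ then x / n else 0 :
          Matrix (Fin d₀) (Fin 1) ℝ) * (Matrix.of fun _ _ => 1 : Matrix (Fin 1) (Fin d₀) ℝ)) ≤ δ := by
    intro x hx
    rw [div_lt_iff₀ hδ] at hx
    refine frobNorm_le hδ.le ?_
    have h1 : (1 : ℝ) ≤ d₀ := by exact_mod_cast hd₀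
    have h2 : d₀ * (|x| / n) ≤ δ := by rw [← mul_div_assoc, div_le_iff₀ hn0]; linarith
    simp only [Matrix.mul_apply, Matrix.of_apply, mul_one, ite_pow, Finset.sum_const,
      Finset.card_univ, Fintype.card_fin, nsmul_eq_mul, Nat.cast_one, one_mul,
      ne_eq, OfNat.ofNat_ne_zero, not_false_eq_true, zero_pow, ← Finset.mul_sum,
      Finset.sum_ite_eq', Finset.mem_univ, if_true]
    rw [← sq_abs (x / n), abs_div, Nat.abs_cast]
    calc (d₀ : ℝ) * (|x| / n) ^ 2 ≤ d₀ ^ 2 * (|x| / n) ^ 2 :=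
          mul_le_mul_of_nonneg_right (le_self_pow₀ h1 two_ne_zero) (sq_nonneg _)
      _ = (d₀ * (|x| / n)) ^ 2 := by ring
      _ ≤ δ ^ 2 := pow_le_pow_left₀ (by positivity) h2 2
  refine ⟨n + n,
    ⟨Fin.append (fun _ => 0) fun _ => Matrix.of fun _ _ => 1,
      Fin.append (fun _ => 0) fun _ => Matrix.of fun _ _ => 1,
      fun _ => Matrix.of fun _ _ => 1,
      Fin.append (fun _ => Matrix.of fun a _ => if a = ⟨0, hd₀⟩ then A * L / n else 0)
        fun _ => Matrix.of fun a _ => if a = ⟨0, hd₀⟩ then B / n else 0⟩, by omega, ?_, ?_⟩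
  · intro k
    refine Fin.addCases (fun k => ?_) (fun k => ?_) k
    · simp only [Fin.append_left]
      refine ⟨?_, hcoef _ ((le_max_left _ _).trans_lt hn)⟩
      rw [Matrix.mul_zero, frobNorm_zero]
      positivity
    · simp only [Fin.append_right]
      refine ⟨frobNorm_le (by positivity) (le_of_eq ?_), hcoef _ ((le_max_right _ _).trans_lt hn)⟩
      simp [Matrix.mul_apply, sq]
  · intro Z a b
    have hL : (L : ℝ) ≠ 0 := by
      have := b.pos
      positivity
    simp only [SAParams.layer_apply, Fin.sum_univ_add, Fin.append_left, Fin.append_right,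
      Finset.sum_const, Finset.card_univ, Fintype.card_fin, Matrix.of_apply, Fin.sum_univ_one,
      Matrix.zero_apply, Real.exp_zero, one_mul, nsmul_eq_mul, mul_one, ite_mul, zero_mul,
      mul_zero]
    split_ifs
    · rw [softMean]
      simp only [Finset.sum_div, Finset.mul_sum (s := Finset.univ (α := Fin L)), add_right_inj]
      congr 1
      · refine Finset.sum_congr rfl fun c _ => ?_
        field_simp
      · refine Finset.sum_congr rfl fun c _ => ?_
        field_simp
    · simp

lemma SAParams.layer_of_WO_eq_zero {h s d₀ L : ℕ} {q : SAParams h s d₀} (hq : ∀ n, q.WO n = 0)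
    (Z : Matrix (Fin d₀) (Fin L) ℝ) : q.layer Z = Z := by
  simp [SAParams.layer, hq]

/-- A self-attention layer is Lipschitz on bounded sets, being continuously differentiable.
(It is not Lipschitz on the whole space.)  The norm is the largest modulus of an entry. -/
lemma SAParams.exists_lipschitzOnWith {h s d₀ L : ℕ} (q : SAParams h s d₀) (R : ℝ) :
    ∃ K, LipschitzOnWith K (fun Z : Fin d₀ → Fin L → ℝ => fun a b => q.layer (Matrix.of Z) a b)
      (Metric.closedBall 0 R) := by
  refine LocallyLipschitzOn.exists_lipschitzOnWith_of_compact (isCompact_closedBall _ _)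
    (ContDiff.locallyLipschitz (𝕂 := ℝ)
      (contDiff_pi.2 fun a => contDiff_pi.2 fun b => ?_)).locallyLipschitzOn
  have hlin : ∀ (w : Fin d₀ → ℝ) (c : Fin L),
      ContDiff ℝ 1 fun Z : Fin d₀ → Fin L → ℝ => ∑ j, w j * Z j c := fun w c => by
    fun_prop
  have hscore : ∀ (n : Fin h) (c : Fin L), ContDiff ℝ 1 fun Z : Fin d₀ → Fin L → ℝ =>
      Real.exp (∑ l, (∑ j, q.WK n l j * Z j c) * ∑ j, q.WQ n l j * Z j b) := fun n c =>
    (ContDiff.sum fun l _ => (hlin _ c).mul (hlin _ b)).exp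
  simp only [SAParams.layer_apply, Matrix.of_apply]
  refine ContDiff.add (by fun_prop) (ContDiff.sum fun n _ => ContDiff.sum fun c _ => ?_)
  exact (ContDiff.sum fun l _ => contDiff_const.mul (hlin _ c)).mul
    ((hscore n c).div (ContDiff.sum fun c' _ => hscore n c') fun Z => (sum_exp_pos _ b).ne')

/-- Bounds for the largest entry turn into bounds for the Frobenius norm. -/
lemma frobNorm_le_mul_norm {d₀ L : ℕ} (Z : Fin d₀ → Fin L → ℝ) :
    frobNorm (Matrix.of Z) ≤ (d₀ * L : ℝ) * ‖Z‖ := by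
  refine frobNorm_le (by positivity) ?_
  calc ∑ a, ∑ b, Z a b ^ 2 ≤ ∑ _a : Fin d₀, ∑ _b : Fin L, ‖Z‖ ^ 2 := by
        refine Finset.sum_le_sum fun a _ => Finset.sum_le_sum fun b _ => ?_
        exact sq_le_sq.2 (((norm_le_pi_norm (Z a) b).trans (norm_le_pi_norm Z a)).trans
          (le_abs_self _))
    _ = (d₀ * L : ℕ) * ‖Z‖ ^ 2 := by simp [mul_assoc]
    _ ≤ ((d₀ * L : ℝ) * ‖Z‖) ^ 2 := by
        rw [mul_pow]
        refine mul_le_mul_of_nonneg_right ?_ (sq_nonneg _)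
        exact_mod_cast Nat.le_self_pow two_ne_zero _

lemma norm_le_frobNorm {d₀ L : ℕ} (Z : Fin d₀ → Fin L → ℝ) : ‖Z‖ ≤ frobNorm (Matrix.of Z) := by
  refine (pi_norm_le_iff_of_nonneg (frobNorm_nonneg _)).2 fun a =>
    (pi_norm_le_iff_of_nonneg (frobNorm_nonneg _)).2 fun b => Real.abs_le_sqrt ?_
  exact (Finset.single_le_sum (f := fun b => Z a b ^ 2) (fun _ _ => sq_nonneg _)
    (Finset.mem_univ b)).trans (Finset.single_le_sum (f := fun a => ∑ b, Z a b ^ 2)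
      (fun _ _ => Finset.sum_nonneg fun _ _ => sq_nonneg _) (Finset.mem_univ a))

/-! ### Encoding of positions, tokens and time -/

/-- The positional encoding of the `y`-th entry of the reshaped input.  Entries that hold the time
are moved to disjoint intervals on the negative half-line, the other ones are told apart by
different fractional parts. -/
noncomputable def offset (d M y : ℕ) : ℝ :=
  if y % (d + 1) = d then -(2 * y + 2) else y / (2 * M)

/-- The `y`-th entry of the repeated input, with its positional encoding. -/
noncomputable def entry {d : ℕ} (M y : ℕ) (v : Fin (d + 1) → ℝ) : ℝ :=
  v (Fin.ofNat (d + 1) y) + offset d M y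

/-- The token (starting from zero) at the `y`-th entry of the repeated input, and `0` at the
entries that hold the time. -/
def digit {d M : ℕ} (x : State d M) (y : ℕ) : ℕ :=
  if h : y % (d + 1) < d then x ⟨y % (d + 1), h⟩ else 0

/-- The number that encodes a token `a` at the entry `y`: the entry, plus the token as a digit in
base `M` if `y < d`, that is, where the tokens occur for the first time. -/
noncomputable def codeValue (d M y a : ℕ) : ℝ :=
  y + if y < d then (a * M ^ y : ℝ) / M ^ d else 0

/-- A function that is one at the entry `y` if it holds the token `a`, and zero at all other
entries. -/
noncomputable def tokenBump (M y a : ℕ) (z : ℝ) : ℝ :=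
  ramp (2 * M * z + (1 - (2 * M * (a + 1) + y))) - ramp (2 * M * z + -(2 * M * (a + 1) + y))

/-- A function that is one at the entry `y` if it holds the time, and zero at all other entries. -/
noncomputable def timePlateau (y : ℕ) (z : ℝ) : ℝ :=
  ramp (1 * z + (2 * y + 3)) - ramp (1 * z + (2 * y + 1))

/-- A function that is the time at the entry `y` if it holds the time, and zero at all other
entries. -/
noncomputable def timeTent (y : ℕ) (z : ℝ) : ℝ :=
  ramp (1 * z + (2 * y + 2)) - ramp (1 * z + (2 * y + 1))

/-- The function that recovers `codeValue` from an entry. -/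
noncomputable def code (d M : ℕ) (z : ℝ) : ℝ :=
  ∑ y ∈ Finset.range M, if y % (d + 1) = d then codeValue d M y 0 * timePlateau y z
    else ∑ a ∈ Finset.range M, codeValue d M y a * tokenBump M y a z

lemma timeTent_mem_rampSpan (y : ℕ) : timeTent y ∈ rampSpan :=
  rampSpan.sub_mem (ramp_mem_rampSpan _ _) (ramp_mem_rampSpan _ _)

lemma code_mem_rampSpan (d M : ℕ) : code d M ∈ rampSpan := by
  have : code d M = ∑ y ∈ Finset.range M, if y % (d + 1) = d then codeValue d M y 0 • timePlateau y
    else ∑ a ∈ Finset.range M, codeValue d M y a • tokenBump M y a := by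
    funext z
    rw [Finset.sum_apply]
    refine Finset.sum_congr rfl fun y _ => ?_
    split_ifs <;> simp
  rw [this]
  refine rampSpan.sum_mem fun y _ => ?_
  split_ifs
  · exact rampSpan.smul_mem _ (rampSpan.sub_mem (ramp_mem_rampSpan _ _) (ramp_mem_rampSpan _ _))
  · exact rampSpan.sum_mem fun a _ => rampSpan.smul_mem _
      (rampSpan.sub_mem (ramp_mem_rampSpan _ _) (ramp_mem_rampSpan _ _))

lemma tokenBump_token {M y a y' a' : ℕ} (hy : y < M) (hy' : y' < M) :
    tokenBump M y' a' (a + 1 + y / (2 * M)) = if y' = y ∧ a' = a then 1 else 0 := by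
  have hM : (2 * M : ℝ) ≠ 0 := by
    have : (0 : ℝ) < M := by exact_mod_cast (Nat.zero_le y).trans_lt hy
    positivity
  have h : (2 * M : ℝ) * (a + 1 + y / (2 * M)) = 2 * M * (a + 1) + y := by
    rw [mul_add, mul_div_cancel₀ _ hM]
  rw [tokenBump, h]
  convert ramp_int_succ_sub (2 * M * (a - a') + (y - y')) using 2
  · push_cast; congr 1; ring
  · push_cast; congr 1; ring
  · constructor
    · rintro ⟨rfl, rfl⟩; ring
    · intro h0
      have ha : (a : ℤ) - a' = 0 := by
        by_contra hne
        rcases lt_or_gt_of_ne hne with h1 | h1 <;> nlinarith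
      rw [ha] at h0
      omega

lemma tokenBump_of_nonpos {M y a : ℕ} (hM : 0 < M) {z : ℝ} (hz : z ≤ 0) :
    tokenBump M y a z = 0 := by
  have hM' : (1 : ℝ) ≤ M := by exact_mod_cast hM
  have h : (2 * M * z + (1 - (2 * M * (a + 1) + y)) : ℝ) ≤ 0 := by
    have h1 : (M : ℝ) * z ≤ 0 := mul_nonpos_of_nonneg_of_nonpos (by linarith) hz
    have h2 : (0 : ℝ) ≤ M * a := by positivity
    have h3 : (0 : ℝ) ≤ y := by positivity
    nlinarith
  rw [tokenBump, ramp_of_nonpos h, ramp_of_nonpos (by linarith), sub_zero]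

lemma timePlateau_of_nonneg {y : ℕ} {z : ℝ} (hz : 0 ≤ z) : timePlateau y z = 0 := by
  have : (0 : ℝ) ≤ y := by positivity
  rw [timePlateau, ramp_of_one_le (by linarith), ramp_of_one_le (by linarith), sub_self]

lemma timeTent_of_nonneg {y : ℕ} {z : ℝ} (hz : 0 ≤ z) : timeTent y z = 0 := by
  have : (0 : ℝ) ≤ y := by positivity
  rw [timeTent, ramp_of_one_le (by linarith), ramp_of_one_le (by linarith), sub_self]

lemma timePlateau_time {y y' : ℕ} {t : ℝ} (h0 : 0 ≤ t) (h1 : t ≤ 1) :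
    timePlateau y' (t + -(2 * y + 2)) = if y' = y then 1 else 0 := by
  rw [timePlateau]
  rcases lt_trichotomy y' y with h | h | h
  · have : (y' : ℝ) + 1 ≤ y := by exact_mod_cast h
    rw [ramp_of_nonpos (by linarith), ramp_of_nonpos (by linarith), if_neg h.ne, sub_zero]
  · subst h
    rw [ramp_of_one_le (by linarith), ramp_of_nonpos (by linarith), if_pos rfl, sub_zero]
  · have : (y : ℝ) + 1 ≤ y' := by exact_mod_cast h
    rw [ramp_of_one_le (by linarith), ramp_of_one_le (by linarith), if_neg h.ne', sub_self]

lemma timeTent_time {y y' : ℕ} {t : ℝ} (h0 : 0 ≤ t) (h1 : t ≤ 1) :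
    timeTent y' (t + -(2 * y + 2)) = if y' = y then t else 0 := by
  rw [timeTent]
  rcases lt_trichotomy y' y with h | h | h
  · have : (y' : ℝ) + 1 ≤ y := by exact_mod_cast h
    rw [ramp_of_nonpos (by linarith), ramp_of_nonpos (by linarith), if_neg h.ne, sub_zero]
  · subst h
    rw [ramp_of_mem (by linarith) (by linarith), ramp_of_nonpos (by linarith), if_pos rfl]; ring
  · have : (y : ℝ) + 1 ≤ y' := by exact_mod_cast h
    rw [ramp_of_one_le (by linarith), ramp_of_one_le (by linarith), if_neg h.ne', sub_self]

lemma entry_embed_of_eq {d M y : ℕ} (x : State d M) (t : ℝ) (hy : y % (d + 1) = d) :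
    entry M y (embed x t) = t + -(2 * y + 2) := by
  have : Fin.ofNat (d + 1) y = Fin.last d := Fin.ext hy
  rw [entry, offset, if_pos hy, this, embed, Fin.snoc_last]

lemma entry_embed_of_ne {d M y : ℕ} (x : State d M) (t : ℝ) (hy : y % (d + 1) ≠ d) :
    entry M y (embed x t) = digit x y + 1 + y / (2 * M) := by
  have hlt : y % (d + 1) < d := by have := Nat.mod_lt y d.add_one_pos; omega
  have : Fin.ofNat (d + 1) y = Fin.castSucc ⟨y % (d + 1), hlt⟩ := Fin.ext rfl
  rw [entry, offset, if_neg hy, this, embed, Fin.snoc_castSucc, digit, dif_pos hlt, token]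

lemma digit_lt {d M : ℕ} (hM : 0 < M) (x : State d M) (y : ℕ) : digit x y < M := by
  rw [digit]; split_ifs
  exacts [Fin.is_lt _, hM]

lemma code_entry {d M y : ℕ} (hy : y < M) (x : State d M) {t : ℝ} (h0 : 0 ≤ t) (h1 : t ≤ 1) :
    code d M (entry M y (embed x t)) = codeValue d M y (digit x y) := by
  have hM : 0 < M := (Nat.zero_le y).trans_lt hy
  by_cases h : y % (d + 1) = d
  · have hd : digit x y = 0 := by rw [digit, dif_neg (by omega)]
    have hneg : t + -(2 * (y : ℝ) + 2) ≤ 0 := by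
      have : (0 : ℝ) ≤ y := by positivity
      linarith
    rw [entry_embed_of_eq x t h, hd, code, Finset.sum_eq_single y]
    · rw [if_pos h, timePlateau_time h0 h1, if_pos rfl, mul_one]
    · intro y' _ hne
      split_ifs
      · rw [timePlateau_time h0 h1, if_neg hne, mul_zero]
      · exact Finset.sum_eq_zero fun a _ => by rw [tokenBump_of_nonpos hM hneg, mul_zero]
    · simp [hy]
  · have hpos : (0 : ℝ) ≤ digit x y + 1 + y / (2 * M) := by positivity
    rw [entry_embed_of_ne x t h, code, Finset.sum_eq_single y]
    · rw [if_neg h, Finset.sum_eq_single (digit x y)]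
      · rw [tokenBump_token hy hy, if_pos ⟨rfl, rfl⟩, mul_one]
      · intro a _ hne
        rw [tokenBump_token hy hy, if_neg (by tauto), mul_zero]
      · simp [digit_lt hM x y]
    · intro y' hy' hne
      split_ifs
      · rw [timePlateau_of_nonneg hpos, mul_zero]
      · refine Finset.sum_eq_zero fun a _ => ?_
        rw [tokenBump_token hy (Finset.mem_range.1 hy'), if_neg (by tauto), mul_zero]
    · simp [hy]

lemma timeTent_entry {d M y : ℕ} (x : State d M) {t : ℝ} (h0 : 0 ≤ t) (h1 : t ≤ 1) :
    timeTent d (entry M y (embed x t)) = if y = d then t else 0 := by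
  by_cases h : y % (d + 1) = d
  · rw [entry_embed_of_eq x t h, timeTent_time h0 h1]
    simp only [eq_comm]
  · rw [entry_embed_of_ne x t h, timeTent_of_nonneg (by positivity), if_neg]
    rintro rfl
    exact h (Nat.mod_eq_of_lt (Nat.lt_succ_self _))

lemma le_codeValue (d M y a : ℕ) : (y : ℝ) ≤ codeValue d M y a := by
  rw [codeValue]
  split_ifs
  · exact le_add_of_nonneg_right (by positivity)
  · simp

lemma codeValue_lt {d M y a : ℕ} (ha : a < M) : codeValue d M y a < y + 1 := by
  rw [codeValue]
  split_ifs with h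
  · have hM : (0 : ℝ) < M := by exact_mod_cast (Nat.zero_le a).trans_lt ha
    rw [add_lt_add_iff_left, div_lt_one (by positivity)]
    have h1 : (a : ℝ) * M ^ y < M * M ^ y :=
      mul_lt_mul_of_pos_right (by exact_mod_cast ha) (by positivity)
    rw [← pow_succ'] at h1
    exact h1.trans_le (pow_le_pow_right₀ (by exact_mod_cast (Nat.zero_le a).trans_lt ha) h)
  · simp

/-- The sum of all encoded tokens determines the state, by uniqueness of base `M` digits. -/
lemma sum_codeValue_injective {d M : ℕ} (hd : d ≤ M) :
    Function.Injective fun x : State d M => ∑ y ∈ Finset.range M, codeValue d M y (digit x y) := by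
  have key : ∀ x : State d M, ∑ y ∈ Finset.range M, codeValue d M y (digit x y) =
      (∑ y ∈ Finset.range M, (y : ℝ)) + (finFunctionFinEquiv x : ℕ) / M ^ d := by
    intro x
    simp only [codeValue, Finset.sum_add_distrib, add_right_inj]
    rw [← Finset.sum_filter]
    have : (Finset.range M).filter (· < d) = Finset.range d := by
      ext y; simp only [Finset.mem_filter, Finset.mem_range]; omega
    rw [this, finFunctionFinEquiv_apply, ← Fin.sum_univ_eq_sum_range
      (fun y => ((digit x y : ℕ) * (M : ℝ) ^ y) / M ^ d) d, Nat.cast_sum, Finset.sum_div]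
    refine Finset.sum_congr rfl fun k _ => ?_
    have hk : (k : ℕ) % (d + 1) = k := Nat.mod_eq_of_lt (by omega)
    have : digit x k = x k := by
      rw [digit, dif_pos (by rw [hk]; exact k.2)]
      congr 2
      exact Fin.ext hk
    rw [this]
    push_cast
    rfl
  intro x x' h
  simp only [key, add_right_inj] at h
  rcases Nat.eq_zero_or_pos d with rfl | hd0
  · exact Subsingleton.elim _ _
  have hM : (0 : ℝ) < M := by exact_mod_cast hd0.trans_le hd
  rw [div_left_inj' (by positivity), Nat.cast_inj] at h
  exact finFunctionFinEquiv.injective (Fin.ext h)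

lemma sum_sum_eq_sum_range {L d₀ : ℕ} (φ : ℕ → ℝ) :
    ∑ b : Fin L, ∑ a : Fin d₀, φ (b * d₀ + a) = ∑ y ∈ Finset.range (L * d₀), φ y := by
  rw [Finset.sum_range, ← finProdFinEquiv.sum_comp, Fintype.sum_prod_type]
  refine Finset.sum_congr rfl fun b _ => Finset.sum_congr rfl fun a _ => congrArg φ ?_
  rw [finProdFinEquiv_apply_val]
  ring

/-! ### Separation of the inputs by one number -/

lemma exists_pos_forall_le {ι : Type*} [Finite ι] (f : ι → ℝ) (hf : ∀ i, 0 < f i) :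
    ∃ g, 0 < g ∧ ∀ i, g ≤ f i := by
  rcases isEmpty_or_nonempty ι with h | h
  · exact ⟨1, one_pos, fun i => h.elim i⟩
  · obtain ⟨i, hi⟩ := Finite.exists_min f
    exact ⟨f i, hf i, hi⟩

lemma exists_forall_le_of_finite {ι : Type*} [Finite ι] (f : ι → ℝ) :
    ∃ C, 0 ≤ C ∧ ∀ i, f i ≤ C := by
  obtain ⟨C, hC⟩ := (Set.finite_range f).bddAbove
  exact ⟨max C 0, le_max_right _ _, fun i => (hC ⟨i, rfl⟩).trans (le_max_left _ _)⟩

/-- Separation by scales: for large `S` the values of `N` are separated whatever the other terms are, and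
`s ↦ S * s` dominates the variation of `D` in `s`; for small `ν` the range of the parameter
`s = ν * t` is too short to interfere with the separation of the indices `b` by `D`. -/
lemma exists_separating {B X : Type*} [Finite B] [Finite X] {N : X → ℝ}
    (hN : Function.Injective N) {D : B → X → ℝ → ℝ} (hD : ∀ b x, ContDiff ℝ 1 (D b x))
    (h0 : ∀ x b b', b ≠ b' → D b x 0 ≠ D b' x 0) :
    ∃ S ν : ℝ, 0 < ν ∧ ν ≤ 1 ∧ ∀ b b' x x', ∀ t ∈ Set.Icc (0 : ℝ) 1, ∀ t' ∈ Set.Icc (0 : ℝ) 1,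
      S * (N x + ν * t) + D b x (ν * t) = S * (N x' + ν * t') + D b' x' (ν * t') →
        b = b' ∧ x = x' ∧ t = t' := by
  have hlip : ∀ i : B × X, ∃ K : NNReal, LipschitzOnWith K (D i.1 i.2) (Set.Icc 0 1) := fun i =>
    ((hD i.1 i.2).locallyLipschitz (𝕂 := ℝ)).locallyLipschitzOn.exists_lipschitzOnWith_of_compact
      isCompact_Icc
  choose K hK using hlip
  obtain ⟨C, hC0, hC⟩ := exists_forall_le_of_finite fun i => (K i : ℝ)
  have hDlip : ∀ b x, ∀ s ∈ Set.Icc (0 : ℝ) 1, ∀ s' ∈ Set.Icc (0 : ℝ) 1,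
      |D b x s - D b x s'| ≤ C * |s - s'| := fun b x s hs s' hs' =>
    ((hK (b, x)).dist_le_mul s hs s' hs').trans
      (mul_le_mul_of_nonneg_right (hC (b, x)) dist_nonneg)
  obtain ⟨A, hA0, hA⟩ := exists_forall_le_of_finite fun i : B × X => |D i.1 i.2 0|
  have hDle : ∀ b x, ∀ s ∈ Set.Icc (0 : ℝ) 1, |D b x s| ≤ A + C := fun b x s hs => by
    have h1 := hDlip b x s hs 0 ⟨le_rfl, zero_le_one⟩
    have h2 := hA (b, x)
    have h3 : C * |s - 0| ≤ C := by
      rw [sub_zero, abs_of_nonneg hs.1]; exact mul_le_of_le_one_right hC0 hs.2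
    have := abs_sub_abs_le_abs_sub (D b x s) (D b x 0)
    dsimp only at h2
    linarith
  obtain ⟨g, hg0, hg⟩ := exists_pos_forall_le
    (fun i : {p : X × X // p.1 ≠ p.2} => |N i.1.1 - N i.1.2|)
    fun i => abs_pos.2 (sub_ne_zero.2 (hN.ne i.2))
  obtain ⟨δ, hδ0, hδ⟩ := exists_pos_forall_le
    (fun i : X × {p : B × B // p.1 ≠ p.2} => |D i.2.1.1 i.1 0 - D i.2.1.2 i.1 0|)
    fun i => abs_pos.2 (sub_ne_zero.2 (h0 i.1 _ _ i.2.2))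
  obtain ⟨S, hSC, hSg⟩ : ∃ S, C < S ∧ 2 * (A + C) < S * (g / 2) := by
    refine ⟨max (C + 1) ((2 * (A + C) + 1) / (g / 2)), by
      linarith [le_max_left (C + 1) ((2 * (A + C) + 1) / (g / 2))], ?_⟩
    have := (div_le_iff₀ (half_pos hg0)).1 (le_max_right (C + 1) ((2 * (A + C) + 1) / (g / 2)))
    linarith
  have hS : 0 < S := hC0.trans_lt hSC
  obtain ⟨ν, hν0, hν1, hνg, hνδ⟩ : ∃ ν : ℝ, 0 < ν ∧ ν ≤ 1 ∧ ν ≤ g / 2 ∧ (S + 2 * C) * ν < δ := by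
    refine ⟨min 1 (min (g / 2) (δ / (2 * (S + 2 * C)))), by positivity, min_le_left _ _,
      (min_le_right _ _).trans (min_le_left _ _), ?_⟩
    calc _ ≤ (S + 2 * C) * (δ / (2 * (S + 2 * C))) := mul_le_mul_of_nonneg_left
          ((min_le_right _ _).trans (min_le_right _ _)) (by positivity)
      _ = δ / 2 := by field_simp
      _ < δ := half_lt_self hδ0
  refine ⟨S, ν, hν0, hν1, fun b b' x x' t ht t' ht' heq => ?_⟩
  have hmem : ∀ t ∈ Set.Icc (0 : ℝ) 1, ν * t ∈ Set.Icc (0 : ℝ) 1 := fun t ht =>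
    ⟨mul_nonneg hν0.le ht.1, mul_le_one₀ hν1 ht.1 ht.2⟩
  have hs : |ν * t - ν * t'| ≤ ν := by
    rw [← mul_sub, abs_mul, abs_of_pos hν0]
    exact mul_le_of_le_one_right hν0.le (abs_le.2 ⟨by linarith [ht.1, ht'.2], by
      linarith [ht.2, ht'.1]⟩)
  have hx : x = x' := by
    by_contra hne
    have h1 := hg ⟨(x, x'), hne⟩
    dsimp only at h1
    have h2 : S * |N x - N x' + (ν * t - ν * t')| ≤ 2 * (A + C) := by
      rw [← abs_of_pos hS, ← abs_mul]
      have : S * (N x - N x' + (ν * t - ν * t')) = D b' x' (ν * t') - D b x (ν * t) := by linarith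
      rw [this]
      refine (abs_sub _ _).trans ?_
      linarith [hDle b' x' _ (hmem t' ht'), hDle b x _ (hmem t ht)]
    have h3 : g / 2 ≤ |N x - N x' + (ν * t - ν * t')| := by
      have := abs_sub_abs_le_abs_sub (N x - N x') (-(ν * t - ν * t'))
      rw [sub_neg_eq_add, abs_neg] at this
      linarith
    linarith [mul_le_mul_of_nonneg_left h3 hS.le]
  subst hx
  have hb : b = b' := by
    by_contra hne
    have h1 := hδ (x, ⟨(b, b'), hne⟩)
    dsimp only at h1
    have h2 : |D b x (ν * t) - D b' x (ν * t')| ≤ S * ν := by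
      have : D b x (ν * t) - D b' x (ν * t') = -(S * (ν * t - ν * t')) := by linarith
      rw [this, abs_neg, abs_mul, abs_of_pos hS]
      exact mul_le_mul_of_nonneg_left hs hS.le
    have hz : ∀ b, ∀ t ∈ Set.Icc (0 : ℝ) 1, |D b x 0 - D b x (ν * t)| ≤ C * ν := fun b t ht => by
      refine (hDlip b x 0 ⟨le_rfl, zero_le_one⟩ _ (hmem t ht)).trans
        (mul_le_mul_of_nonneg_left ?_ hC0)
      rw [zero_sub, abs_neg, abs_of_nonneg (hmem t ht).1]
      exact mul_le_of_le_one_right hν0.le ht.2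
    have h3 := abs_le.1 (hz b t ht)
    have h4 := abs_le.1 (hz b' t' ht')
    have h5 := abs_le.1 h2
    have h6 : |D b x 0 - D b' x 0| ≤ (S + 2 * C) * ν :=
      abs_le.2 ⟨by linarith [h3.1, h4.2, h5.1], by linarith [h3.2, h4.1, h5.2]⟩
    linarith
  subst hb
  refine ⟨rfl, rfl, ?_⟩
  by_contra hne
  have h1 := hDlip b x _ (hmem t ht) _ (hmem t' ht')
  have h2 : D b x (ν * t) - D b x (ν * t') = -(S * (ν * t - ν * t')) := by linarith
  rw [h2, abs_neg, abs_mul, abs_of_pos hS] at h1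
  have h3 : 0 < |ν * t - ν * t'| := by
    rw [← mul_sub]; exact abs_pos.2 (mul_ne_zero hν0.ne' (sub_ne_zero.2 hne))
  nlinarith

/-- A continuous function on a compact space is a continuous function of any continuous injective
real function on this space, by Tietze's theorem. -/
lemma exists_continuous_comp_eq {X : Type*} [TopologicalSpace X] [CompactSpace X] {ρ h : X → ℝ}
    (hρ : Continuous ρ) (hinj : Function.Injective ρ) (hh : Continuous h) :
    ∃ g : ℝ → ℝ, Continuous g ∧ ∀ p, g (ρ p) = h p := by
  obtain ⟨g, hg⟩ := ContinuousMap.exists_extension (hρ.isClosedEmbedding hinj) ⟨h, hh⟩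
  exact ⟨g, g.continuous, fun p => DFunLike.congr_fun hg p⟩

/-! ### Approximation by one attention layer between two feed-forward layers -/

/-- Boundedness and the Lipschitz property survive the attention layer, because the first layer
maps into a bounded set. -/
lemma exists_bound_and_lipschitz {h s d₀ L : ℕ} (q : SAParams h s d₀) {φ : ℝ → ℝ}
    (hφ : φ ∈ rampSpan) {ψ : Fin d₀ → ℝ → ℝ} (hψ : ∀ a, ψ a ∈ rampSpan) {Q : ℝ} (i : Fin d₀)
    {f : Matrix (Fin d₀) (Fin L) ℝ → Matrix (Fin d₀) (Fin L) ℝ}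
    (hf : ∀ Z a b, f Z a b = ψ a (Q * q.layer (Matrix.of fun a b => φ (Z a b)) i b)) :
    ∃ CT LT, (∀ Z, frobNorm (f Z) ≤ CT) ∧
      ∀ Z₁ Z₂, frobNorm (f Z₁ - f Z₂) ≤ LT * frobNorm (Z₁ - Z₂) := by
  obtain ⟨⟨C₁, hC₁⟩, K₁, hK₁⟩ := bounded_and_lipschitz_of_mem_rampSpan hφ
  obtain ⟨K₂, hK₂⟩ := q.exists_lipschitzOnWith (L := L) C₁
  choose C hC using fun a => (bounded_and_lipschitz_of_mem_rampSpan (hψ a)).1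
  choose K hK using fun a => (bounded_and_lipschitz_of_mem_rampSpan (hψ a)).2
  obtain ⟨C₃, hC₃0, hC₃⟩ := exists_forall_le_of_finite C
  obtain ⟨K₃, hK₃0, hK₃⟩ := exists_forall_le_of_finite fun a => (K a : ℝ)
  have hball : ∀ Z : Fin d₀ → Fin L → ℝ,
      (fun a b => φ (Z a b)) ∈ Metric.closedBall (0 : Fin d₀ → Fin L → ℝ) C₁ := fun Z => by
    have hC₁0 : 0 ≤ C₁ := (abs_nonneg _).trans (hC₁ 0)
    rw [mem_closedBall_zero_iff]
    exact (pi_norm_le_iff_of_nonneg hC₁0).2 fun a =>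
      (pi_norm_le_iff_of_nonneg hC₁0).2 fun b => hC₁ _
  refine ⟨d₀ * L * C₃, d₀ * L * (K₃ * |Q| * K₂ * K₁), fun Z => ?_, fun Z₁ Z₂ => ?_⟩
  · refine (frobNorm_le_mul_norm fun a b => f Z a b).trans ?_
    gcongr
    exact (pi_norm_le_iff_of_nonneg hC₃0).2 fun a => (pi_norm_le_iff_of_nonneg hC₃0).2 fun b => by
      rw [hf]; exact (hC a _).trans (hC₃ a)
  · refine (frobNorm_le_mul_norm fun a b => f Z₁ a b - f Z₂ a b).trans ?_
    rw [mul_assoc (d₀ * L : ℝ)]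
    refine mul_le_mul_of_nonneg_left ?_ (by positivity)
    have hnn : 0 ≤ K₃ * |Q| * K₂ * K₁ * frobNorm (Z₁ - Z₂) := by
      have := frobNorm_nonneg (Z₁ - Z₂)
      positivity
    have hd : dist (fun a b => φ (Z₁ a b)) (fun a b => φ (Z₂ a b)) ≤
        K₁ * frobNorm (Z₁ - Z₂) := by
      have h0 : 0 ≤ K₁ * frobNorm (Z₁ - Z₂) := mul_nonneg K₁.2 (frobNorm_nonneg _)
      refine (dist_pi_le_iff h0).2 fun a => (dist_pi_le_iff h0).2 fun b =>
        (hK₁.dist_le_mul _ _).trans (mul_le_mul_of_nonneg_left ?_ K₁.2)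
      have h1 := norm_le_frobNorm fun a b => Z₁ a b - Z₂ a b
      exact ((norm_le_pi_norm (fun b => Z₁ a b - Z₂ a b) b).trans
        (norm_le_pi_norm (fun a b => Z₁ a b - Z₂ a b) a)).trans h1
    refine (pi_norm_le_iff_of_nonneg hnn).2 fun a => (pi_norm_le_iff_of_nonneg hnn).2 fun b => ?_
    have h2 := (hK₂.dist_le_mul _ (hball Z₁) _ (hball Z₂)).trans
      (mul_le_mul_of_nonneg_left hd K₂.2)
    have h3 := (dist_le_pi_dist _ _ b).trans ((dist_le_pi_dist _ _ i).trans h2)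
    rw [hf, hf, ← dist_eq_norm]
    refine ((hK a).dist_le_mul _ _).trans ?_
    rw [Real.dist_eq, ← mul_sub, abs_mul]
    calc (K a : ℝ) * (|Q| * _) ≤ K₃ * (|Q| * (K₂ * (K₁ * frobNorm (Z₁ - Z₂)))) :=
          mul_le_mul (hK₃ a) (mul_le_mul_of_nonneg_left h3 (abs_nonneg Q)) (by positivity) hK₃0
      _ = _ := by ring

lemma abs_offset_le {d M y : ℕ} (hy : y < M) : |offset d M y| ≤ 2 * M := by
  have h1 : (y : ℝ) + 1 ≤ M := by exact_mod_cast hy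
  have h0 : (0 : ℝ) ≤ y := by positivity
  rw [offset]
  split_ifs
  · rw [abs_neg, abs_of_nonneg (by positivity)]; linarith
  · rw [abs_of_nonneg (by positivity)]
    exact (div_le_one_of_le₀ (by linarith) (by positivity)).trans (by linarith)

/-- The column sums of the encoded input, as a function of the state and the rescaled time `s`. -/
noncomputable def columnCode {d M : ℕ} (d₀ L : ℕ) (lam : ℝ) (x : State d M) (s : ℝ) (b : Fin L) :
    ℝ :=
  ∑ a : Fin d₀, lam * (codeValue d M (b * d₀ + a) (digit x (b * d₀ + a)) +
    if (b * d₀ + a : ℕ) = d then s else 0)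

lemma entry_index_lt {M d₀ L : ℕ} (hM : M = L * d₀) (b : Fin L) (a : Fin d₀) :
    (b * d₀ + a : ℕ) < M := by
  have h1 : ((b : ℕ) + 1) * d₀ ≤ L * d₀ := Nat.mul_le_mul_right _ b.2
  have h2 := a.2
  rw [hM]
  linarith

lemma columnCode_strictMono {d M d₀ L : ℕ} (hd₀ : 0 < d₀) (hM : M = L * d₀) {lam : ℝ}
    (hlam : 0 < lam) (x : State d M) : StrictMono (columnCode d₀ L lam x 0) := by
  intro b b' hb
  have : Nonempty (Fin d₀) := ⟨⟨0, hd₀⟩⟩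
  refine Finset.sum_lt_sum_of_nonempty Finset.univ_nonempty fun a _ =>
    mul_lt_mul_of_pos_left ?_ hlam
  simp only [ite_self, add_zero]
  have hM0 := (Nat.zero_le _).trans_lt (entry_index_lt hM b a)
  refine (codeValue_lt (digit_lt hM0 x _)).trans_le (le_trans ?_ (le_codeValue d M _ _))
  have h1 : ((b : ℕ) + 1) * d₀ ≤ b' * d₀ := Nat.mul_le_mul_right _ hb
  have h2 : (b * d₀ + a + 1 : ℕ) ≤ b' * d₀ + a := by linarith
  exact_mod_cast h2

lemma sum_columnCode {d M d₀ L : ℕ} (hM : M = L * d₀) (hdM : d < M) (lam : ℝ) (x : State d M)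
    (s : ℝ) : ∑ b, columnCode d₀ L lam x s b =
      lam * ((∑ y ∈ Finset.range M, codeValue d M y (digit x y)) + s) := by
  simp only [columnCode]
  rw [sum_sum_eq_sum_range fun y => lam * (codeValue d M y (digit x y) + if y = d then s else 0),
    ← hM, ← Finset.mul_sum, Finset.sum_add_distrib, Finset.sum_ite_eq' (Finset.range M) d,
    if_pos (Finset.mem_range.2 hdM)]

lemma contDiff_columnCode {d M d₀ L : ℕ} (lam : ℝ) (x : State d M) (b : Fin L) :
    ContDiff ℝ 1 fun s => columnCode d₀ L lam x s b := by
  refine ContDiff.sum fun a _ => contDiff_const.mul (contDiff_const.add ?_)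
  split_ifs
  exacts [contDiff_id, contDiff_const]

/-- Uniform approximation of a function of state and time that is continuous in time.  The bounds
for the weights only have to exceed the cost of the residual connections, since the network may be
arbitrarily wide. -/
theorem exists_network_approx {d d₀ M L : ℕ} (hd₀ : 0 < d₀) (hM : M = L * d₀) (hdM : d < M)
    {t₀ T : ℝ} (ht₀ : 0 < t₀) (hT : T < 1) {u : State d M → ℝ → Fin M → ℝ}
    (hu : ∀ x y, ContinuousOn (fun t => u x t y) (Set.Icc t₀ T)) (B : Bounds)
    (hKQ : d₀ ≤ B.CKQ) (hKQ' : d₀ ≤ B.CKQinf) (hOV : 0 < B.COV) (hOV' : 0 < B.COVinf)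
    (hE : d₀ * (2 * M) ≤ B.CE) (hF : √(2 * d₀ + 1) ≤ B.CF) (hF' : √(2 * d₀ + 1) ≤ B.CFinf)
    {η : ℝ} (hη : 0 < η) :
    ∃ (h s r : ℕ) (CT LT : ℝ), 0 < h ∧ 0 < s ∧ 0 < r ∧
      ∃ uθ ∈ ReshapedClass h s r d hM { B with CT := CT, LT := LT },
        ∀ t ∈ Set.Icc t₀ T, ∀ x y, |uθ (embed x t) y - u x t y| ≤ η := by
  classical
  -- the first feed-forward layer, up to the choice of the time scale `ν`
  obtain ⟨n₀, C₀, hnet₀⟩ := IsReluNet.exists_of_mem_rampSpan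
    (fun _ : Fin d₀ => code_mem_rampSpan d M) id
  obtain ⟨n₁, C₁, hnet₁⟩ := IsReluNet.exists_of_mem_rampSpan
    (fun _ : Fin d₀ => timeTent_mem_rampSpan d) id
  obtain ⟨lam, hlam, hlamC⟩ : ∃ lam : ℝ, 0 < lam ∧ lam * (C₀ + C₁) ≤ 1 := by
    refine ⟨(|C₀ + C₁| + 1)⁻¹, by positivity, ?_⟩
    rw [inv_mul_le_iff₀ (by positivity)]
    linarith [le_abs_self (C₀ + C₁)]
  -- one number that determines column, state and time
  set N : State d M → ℝ := fun x => ∑ y ∈ Finset.range M, codeValue d M y (digit x y) with hN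
  set D : Fin L → State d M → ℝ → ℝ := fun b x s => softMean (columnCode d₀ L lam x s) b with hD
  have hDc : ∀ b x, ContDiff ℝ 1 (D b x) := fun b x =>
    contDiff_softMean (fun c => contDiff_columnCode lam x c) b
  obtain ⟨S, ν, hν0, hν1, hsep⟩ := exists_separating (sum_codeValue_injective hdM.le) hDc
    fun x b b' hne => by
      have hmono := columnCode_strictMono hd₀ hM hlam x
      rcases lt_or_gt_of_ne hne with h | h
      exacts [(softMean_lt_softMean (hmono h)).ne, (softMean_lt_softMean (hmono h)).ne']
  set ρ : (Fin L × State d M) × Set.Icc t₀ T → ℝ := fun p =>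
    S * (N p.1.2 + ν * p.2) + D p.1.1 p.1.2 (ν * p.2) with hρ
  have hIcc : ∀ t ∈ Set.Icc t₀ T, t ∈ Set.Icc (0 : ℝ) 1 := fun t ht =>
    ⟨ht₀.le.trans ht.1, ht.2.trans hT.le⟩
  have hρc : Continuous ρ := continuous_prod_of_discrete_left.2 fun p => by
    have h1 : Continuous fun t : Set.Icc t₀ T => ν * (t : ℝ) := by fun_prop
    have h2 : Continuous fun t : Set.Icc t₀ T => D p.1 p.2 (ν * t) :=
      (hDc p.1 p.2).continuous.comp h1
    exact Continuous.add (by fun_prop : Continuous fun t : Set.Icc t₀ T => S * (N p.2 + ν * t)) h2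
  have hρi : Function.Injective ρ := by
    rintro ⟨⟨b, x⟩, t⟩ ⟨⟨b', x'⟩, t'⟩ hp
    obtain ⟨rfl, rfl, ht⟩ := hsep b b' x x' t (hIcc _ t.2) t' (hIcc _ t'.2) hp
    rw [Subtype.ext ht]
  -- the second feed-forward layer reads off the value of `u`
  set idx : Fin L → Fin d₀ → Fin M := fun b a => Fin.cast hM.symm (finProdFinEquiv (b, a))
  have hg : ∀ a : Fin d₀, ∃ g : ℝ → ℝ, Continuous g ∧
      ∀ p : (Fin L × State d M) × Set.Icc t₀ T, g (ρ p) = u p.1.2 p.2 (idx p.1.1 a) := fun a =>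
    exists_continuous_comp_eq hρc hρi (continuous_prod_of_discrete_left.2 fun p =>
      continuousOn_iff_continuous_domRestrict.1 (hu p.2 (idx p.1 a)))
  choose g hgc hg using hg
  obtain ⟨R, hR⟩ := isCompact_univ.exists_bound_of_continuousOn hρc.continuousOn
  choose f hf hfg using fun a => exists_mem_rampSpan_approx (hgc a) R (half_pos hη)
  choose C hC using fun a => (bounded_and_lipschitz_of_mem_rampSpan (hf a)).1
  choose K hK using fun a => (bounded_and_lipschitz_of_mem_rampSpan (hf a)).2
  obtain ⟨K', hK'0, hK'⟩ := exists_forall_le_of_finite fun a => (K a : ℝ)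
  obtain ⟨n₂, C₂, hnet₂⟩ := IsReluNet.exists_of_mem_rampSpan hf fun _ => ⟨0, hd₀⟩
  set φ : ℝ → ℝ := lam • (code d M + ν • timeTent d) with hφdef
  have hφ : φ ∈ rampSpan := rampSpan.smul_mem _ (rampSpan.add_mem (code_mem_rampSpan d M)
    (rampSpan.smul_mem _ (timeTent_mem_rampSpan d)))
  obtain ⟨⟨A, hA⟩, -⟩ := bounded_and_lipschitz_of_mem_rampSpan hφ
  have hA0 : 0 ≤ A := (abs_nonneg _).trans (hA 0)
  -- the amplification `Q` makes the residual connection of the attention layer negligible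
  obtain ⟨Q, hQ0, hQC, hQη⟩ : ∃ Q : ℝ, 0 < Q ∧ Q⁻¹ * C₂ ≤ 1 ∧ K' * (Q⁻¹ * A) ≤ η / 2 := by
    have hpos : 0 < 1 + |C₂| + 2 * (K' * A) / η := by positivity
    refine ⟨1 + |C₂| + 2 * (K' * A) / η, hpos, ?_, ?_⟩
    · rw [inv_mul_le_iff₀ hpos]
      have : 0 ≤ 2 * (K' * A) / η := by positivity
      linarith [le_abs_self C₂]
    · rw [mul_left_comm, inv_mul_le_iff₀ hpos, ← div_le_iff₀ (half_pos hη)]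
      have : K' * A / (η / 2) = 2 * (K' * A) / η := by field_simp
      linarith [abs_nonneg C₂]
  obtain ⟨p₁, hp₁, hp₁', hp₁l⟩ := exists_ffParams
    (((hnet₀.add (hnet₁.smul_of_abs_le_one (by rwa [abs_of_pos hν0]))).smul_of_nonneg
      hlam.le).mono hlamC) (le_max_left (n₀ + n₁ + (d₀ + d₀)) (n₂ + (d₀ + d₀)))
  obtain ⟨p₂, hp₂, hp₂', hp₂l⟩ := exists_ffParams ((hnet₂.comp_inv_mul hQ0).mono hQC)
    (le_max_right (n₀ + n₁ + (d₀ + d₀)) (n₂ + (d₀ + d₀)))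
  obtain ⟨h, q, hh, hq, hql⟩ := exists_saParams (L := L) hd₀ (Q * (S / lam)) Q (lt_min hOV hOV')
  have hp₁φ : ∀ Z : Matrix (Fin d₀) (Fin L) ℝ, p₁.layer Z = Matrix.of fun a b => φ (Z a b) :=
    fun Z => by
      ext a b
      rw [hp₁l]
      rfl
  obtain ⟨CT, LT, hCT, hLT⟩ := exists_bound_and_lipschitz (Q := Q⁻¹) (L := L) q hφ hf ⟨0, hd₀⟩
    (f := fun Z => p₂.layer (q.layer (p₁.layer Z))) fun Z a b => by
      rw [hp₂l, hp₁φ]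
  have hp₁B : p₁.Obeys { B with CT := CT, LT := LT } :=
    ⟨((twoInfNorm_le_frobNorm _).trans hp₁).trans hF',
      ((twoInfNorm_le_frobNorm _).trans hp₁').trans hF',
      ((specNorm_le_frobNorm _).trans hp₁).trans hF,
      ((specNorm_le_frobNorm _).trans hp₁').trans hF⟩
  have hp₂B : p₂.Obeys { B with CT := CT, LT := LT } :=
    ⟨((twoInfNorm_le_frobNorm _).trans hp₂).trans hF',
      ((twoInfNorm_le_frobNorm _).trans hp₂').trans hF',
      ((specNorm_le_frobNorm _).trans hp₂).trans hF,
      ((specNorm_le_frobNorm _).trans hp₂').trans hF⟩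
  have hqB : q.Obeys { B with CT := CT, LT := LT } := fun n =>
    ⟨((specNorm_le_frobNorm _).trans (hq n).1).trans hKQ,
      ((twoInfNorm_le_frobNorm _).trans (hq n).1).trans hKQ',
      ((specNorm_le_frobNorm _).trans (hq n).2).trans (min_le_left _ _),
      ((twoInfNorm_le_frobNorm _).trans (hq n).2).trans (min_le_right _ _)⟩
  -- a block starts with an attention layer, so the first block needs a trivial one
  set q₀ : SAParams h 1 d₀ := ⟨0, 0, 0, 0⟩ with hq₀
  have hq₀B : q₀.Obeys { B with CT := CT, LT := LT } := fun n => by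
    have h1 : (q₀.WK n)ᵀ * q₀.WQ n = 0 := Matrix.mul_zero _
    have h2 : q₀.WO n * q₀.WV n = 0 := Matrix.mul_zero _
    have h3 : (0 : ℝ) ≤ d₀ := by positivity
    rw [h1, h2]
    exact ⟨((specNorm_le_frobNorm _).trans_eq frobNorm_zero).trans (h3.trans hKQ),
      ((twoInfNorm_le_frobNorm _).trans_eq frobNorm_zero).trans (h3.trans hKQ'),
      ((specNorm_le_frobNorm _).trans_eq frobNorm_zero).trans hOV.le,
      ((twoInfNorm_le_frobNorm _).trans_eq frobNorm_zero).trans hOV'.le⟩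
  set E : Matrix (Fin d₀) (Fin L) ℝ := Matrix.of fun a b => offset d M (b * d₀ + a) with hEdef
  have hEB : twoInfNorm Eᵀ ≤ B.CE := by
    refine le_trans (Real.iSup_le (fun b => ?_) (by positivity)) hE
    refine Real.sqrt_le_iff.2 ⟨by positivity, ?_⟩
    calc ∑ a, Eᵀ b a ^ 2 ≤ ∑ _a : Fin d₀, (2 * M : ℝ) ^ 2 :=
          Finset.sum_le_sum fun a _ => sq_le_sq.2 ((abs_offset_le (entry_index_lt hM b a)).trans
            (le_abs_self _))
      _ = d₀ * (2 * M : ℝ) ^ 2 := by simp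
      _ ≤ (d₀ * (2 * M)) ^ 2 := by
          rw [mul_pow (d₀ : ℝ)]
          gcongr
          exact_mod_cast Nat.le_self_pow two_ne_zero d₀
  refine ⟨h, 1, _, CT, LT, hh, one_pos, lt_of_lt_of_le (by omega) (le_max_left _ _), _,
    ⟨fun Z => p₂.layer (q.layer (p₁.layer Z)), ⟨⟨⟨[(q, p₂), (q₀, p₁)], by simp, ?_, ?_⟩, hCT, hLT⟩,
      ⟨p₁, q, p₂, hp₁B, hqB, hp₂B, rfl⟩⟩, E, hEB, rfl⟩, fun t ht x y => ?_⟩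
  · rintro b hb
    simp only [List.mem_cons, List.not_mem_nil, or_false] at hb
    rcases hb with rfl | rfl
    exacts [⟨hqB, hp₂B⟩, ⟨hq₀B, hp₁B⟩]
  · funext Z
    change _ = p₂.layer (q.layer (p₁.layer (q₀.layer Z)))
    rw [SAParams.layer_of_WO_eq_zero (q := q₀) fun _ => rfl]
  · set a := (Fin.cast hM y).modNat with ha
    set b := (Fin.cast hM y).divNat with hb
    have hidx : idx b a = y := by
      have : finProdFinEquiv (b, a) = Fin.cast hM y := finProdFinEquiv.apply_symm_apply _
      simp only [idx, this]
      rfl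
    set Z := reshapeIn d₀ L (embed x t) + E with hZ
    have h01 := hIcc t ht
    have hZφ : ∀ j c, φ (Z j c) = lam * (codeValue d M (c * d₀ + j) (digit x (c * d₀ + j)) +
        if (c * d₀ + j : ℕ) = d then ν * t else 0) := fun j c => by
      change lam * (code d M (entry M (c * d₀ + j) (embed x t)) +
        ν * timeTent d (entry M (c * d₀ + j) (embed x t))) = _
      rw [code_entry (entry_index_lt hM c j) x h01.1 h01.2, timeTent_entry x h01.1 h01.2, mul_ite,
        mul_zero]
    have hcol : (fun c => ∑ j, φ (Z j c)) = columnCode d₀ L lam x (ν * t) := by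
      funext c
      exact Finset.sum_congr rfl fun j _ => hZφ j c
    have hlayer : Q⁻¹ * q.layer (p₁.layer Z) ⟨0, hd₀⟩ b =
        ρ ((b, x), ⟨t, ht⟩) + Q⁻¹ * φ (Z ⟨0, hd₀⟩ b) := by
      rw [hp₁φ, hql, if_pos rfl]
      simp only [Matrix.of_apply]
      rw [hcol, sum_columnCode hM hdM]
      simp only [hρ, hN, hD]
      field_simp
      ring
    have hval : reshapeOut hM (p₂.layer (q.layer (p₁.layer Z))) y =
        f a (ρ ((b, x), ⟨t, ht⟩) + Q⁻¹ * φ (Z ⟨0, hd₀⟩ b)) := by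
      rw [← hlayer, reshapeOut, hp₂l]
    rw [hval, ← hidx, ← hg a ((b, x), ⟨t, ht⟩)]
    have h1 : |f a (ρ ((b, x), ⟨t, ht⟩) + Q⁻¹ * φ (Z ⟨0, hd₀⟩ b)) - f a (ρ ((b, x), ⟨t, ht⟩))| ≤
        η / 2 := by
      refine ((hK a).dist_le_mul _ _).trans (le_trans ?_ hQη)
      rw [Real.dist_eq, add_sub_cancel_left, abs_mul, abs_of_pos (inv_pos.2 hQ0)]
      exact mul_le_mul (hK' a) (mul_le_mul_of_nonneg_left (hA _) (inv_pos.2 hQ0).le)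
        (by positivity) hK'0
    have h2 := hfg a (ρ ((b, x), ⟨t, ht⟩)) (abs_le.1 (hR _ (Set.mem_univ _)))
    have h3 := abs_sub_le (f a (ρ ((b, x), ⟨t, ht⟩) + Q⁻¹ * φ (Z ⟨0, hd₀⟩ b)))
      (f a (ρ ((b, x), ⟨t, ht⟩))) (g a (ρ ((b, x), ⟨t, ht⟩)))
    linarith

lemma exists_abs_path_le {d M : ℕ} {κ : ℝ → ℝ} (hκ : IsScheduler κ)
    (π : State d M × State d M → ℝ) {t₀ T : ℝ} (ht₀ : 0 < t₀) (hT : T < 1) :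
    ∃ P, 0 ≤ P ∧ ∀ t ∈ Set.Icc t₀ T, ∀ x, |path κ π t x| ≤ P := by
  have hκc : ContinuousOn κ (Set.Icc t₀ T) :=
    hκ.smooth.continuousOn.mono (Set.Icc_subset_Icc ht₀.le hT.le)
  have hp : ∀ x, ContinuousOn (fun t => path κ π t x) (Set.Icc t₀ T) := fun x => by
    unfold path condPath
    fun_prop
  choose C hC using fun x => isCompact_Icc.exists_bound_of_continuousOn (hp x)
  obtain ⟨P, hP0, hP⟩ := exists_forall_le_of_finite C
  exact ⟨P, hP0, fun t ht x => (hC x t ht).trans (hP x)⟩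

lemma continuousOn_of_mem_holderClass {ι : Type*} {β : ℝ} (hβ : 1 ≤ β) {Ω : Set ℝ} {K : ℝ}
    {f : ℝ → ι → ℝ} (hf : f ∈ HolderClass β Ω K) (y : ι) : ContinuousOn (fun t => f t y) Ω := by
  have := (hf y).1 0 (Nat.floor_pos.2 hβ)
  rw [iteratedDerivWithin_zero] at this
  exact this.continuousOn

end DFM

theorem theorem4p1 (K : ℝ) (hK : 0 < K) :
    -- the hidden factors: `c (d d₀)^p` and, for the key-query bound, also `(log M)^q`
    ∃ (c : ℝ) (p q : ℕ), 0 < c ∧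
    ∀ (d d₀ M L : ℕ), d₀ ∣ d + 1 → d + 1 ∣ M → 0 < M → ∀ (hM : M = L * d₀),
    ∀ (κ : ℝ → ℝ), DFM.IsScheduler κ →
    ∀ (t₀ T : ℝ), 0 < t₀ → t₀ < T → T < 1 →
    ∀ (π : DFM.State d M × DFM.State d M → ℝ), π ∈ stdSimplex ℝ (DFM.State d M × DFM.State d M) →
    ∀ (i : Fin d) (u : DFM.State d M → ℝ → Fin M → ℝ),
    (u = DFM.velocity κ π i ∨ u = DFM.averagedVelocity κ π i) →
    ∀ (β : ℝ), 1 ≤ β →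
    (∀ x, u x ∈ DFM.HolderClass β (Set.Icc t₀ T) K) →
    ∀ (ε : ℝ), 0 < ε → ε < 1 →
    ∃ (h s r : ℕ) (CT LT : ℝ), 0 < h ∧ 0 < s ∧ 0 < r ∧
    ∃ uθ ∈ DFM.ReshapedClass h s r d hM
      { CT := CT
        CKQinf := c * ((d : ℝ) * d₀) ^ p * Real.log M ^ q *
          ((M : ℝ) ^ (6 * d₀ + 3) * (ε ^ (4 * d₀ + 2))⁻¹)
        CKQ := c * ((d : ℝ) * d₀) ^ p * Real.log M ^ q *
          ((M : ℝ) ^ (6 * d₀ + 3) * (ε ^ (4 * d₀ + 2))⁻¹)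
        COVinf := c * ((d : ℝ) * d₀) ^ p * ((M : ℝ) ^ (-(1 / 2) : ℝ) * ε)
        COV := c * ((d : ℝ) * d₀) ^ p * ((M : ℝ) ^ (-(1 / 2) : ℝ) * ε)
        CE := c * ((d : ℝ) * d₀) ^ p * M
        CFinf := c * ((d : ℝ) * d₀) ^ p * ((M : ℝ) ^ 2 * ε⁻¹)
        CF := c * ((d : ℝ) * d₀) ^ p * ((M : ℝ) ^ 2 * ε⁻¹)
        LT := LT },
    ∀ t ∈ Set.Icc t₀ T,
      ∑ x : DFM.State d M,
          (∑ y, (uθ (DFM.embed x t) y - u x t y) ^ 2) * DFM.path κ π t x ≤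
        c * ((d : ℝ) * d₀) ^ p *
          (ε ^ (4 / ((M : ℝ) + 2)) *
            (M : ℝ) ^ ((12 * (M : ℝ) * d₀ + 25 * M) / ((M : ℝ) + 2))) := by
  refine ⟨4, 1, 0, by norm_num, ?_⟩
  intro d d₀ M L hd₀d hdM hM0 hM κ hκ t₀ T ht₀ _ hT π _ i u _ β hβ hu ε hε hε1
  have hd₀ : 0 < d₀ := Nat.pos_of_dvd_of_pos hd₀d d.succ_pos
  have hd : 0 < d := i.pos
  have hd₀1 : (1 : ℝ) ≤ d₀ := by exact_mod_cast hd₀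
  have hd1 : (1 : ℝ) ≤ d := by exact_mod_cast hd
  have hM1 : (1 : ℝ) ≤ M := by exact_mod_cast hM0
  have hε' : 1 ≤ ε⁻¹ := (one_le_inv₀ hε).2 hε1.le
  have hdd : (d₀ : ℝ) ≤ d * d₀ := le_mul_of_one_le_left (by positivity) hd1
  have hF1 : 1 ≤ (M : ℝ) ^ 2 * ε⁻¹ := one_le_mul_of_one_le_of_one_le (one_le_pow₀ hM1) hε'
  have hKQ1 : 1 ≤ (M : ℝ) ^ (6 * d₀ + 3) * (ε ^ (4 * d₀ + 2))⁻¹ :=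
    one_le_mul_of_one_le_of_one_le (one_le_pow₀ hM1)
      ((one_le_inv₀ (by positivity)).2 (pow_le_one₀ hε.le hε1.le))
  obtain ⟨P, hP0, hP⟩ := DFM.exists_abs_path_le hκ π ht₀ hT
  set G : ℝ := 4 * ((d : ℝ) * d₀) ^ 1 * (ε ^ (4 / ((M : ℝ) + 2)) *
    (M : ℝ) ^ ((12 * (M : ℝ) * d₀ + 25 * M) / ((M : ℝ) + 2))) with hG
  have hG0 : 0 < G := by
    have : (0 : ℝ) < M := by positivity
    positivity
  set A : ℝ := Fintype.card (DFM.State d M) * (M * P) with hA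
  have hA0 : 0 ≤ A := by positivity
  -- the tolerance is such that the squared error, summed over tokens and states, is at most `G`
  set η : ℝ := √(G / (A + 1)) with hη
  have hη0 : 0 < η := Real.sqrt_pos.2 (by positivity)
  have hηsq : η ^ 2 = G / (A + 1) := Real.sq_sqrt (by positivity)
  have hKQ : (d₀ : ℝ) ≤ 4 * ((d : ℝ) * d₀) ^ 1 * Real.log M ^ 0 *
      ((M : ℝ) ^ (6 * d₀ + 3) * (ε ^ (4 * d₀ + 2))⁻¹) := by
    rw [pow_one, pow_zero, mul_one]
    exact (by linarith : (d₀ : ℝ) ≤ 4 * (d * d₀)).trans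
      (le_mul_of_one_le_right (by positivity) hKQ1)
  have hOV : 0 < 4 * ((d : ℝ) * d₀) ^ 1 * ((M : ℝ) ^ (-(1 / 2) : ℝ) * ε) := by
    have : (0 : ℝ) < M := by positivity
    positivity
  have hE : d₀ * (2 * M : ℝ) ≤ 4 * ((d : ℝ) * d₀) ^ 1 * M := by
    rw [pow_one]
    nlinarith
  have hF : √(2 * d₀ + 1) ≤ 4 * ((d : ℝ) * d₀) ^ 1 * ((M : ℝ) ^ 2 * ε⁻¹) := by
    rw [pow_one]
    refine le_trans ?_ (le_mul_of_one_le_right (by positivity) hF1)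
    refine Real.sqrt_le_iff.2 ⟨by positivity, ?_⟩
    nlinarith
  obtain ⟨h, s, r, CT, LT, hh, hs, hr, uθ, huθ, happrox⟩ := DFM.exists_network_approx hd₀ hM
    (Nat.le_of_dvd hM0 hdM) ht₀ hT
    (fun x y => DFM.continuousOn_of_mem_holderClass hβ (hu x) y)
    { CT := 0
      CKQinf := _
      CKQ := _
      COVinf := _
      COV := _
      CE := _
      CFinf := _
      CF := _
      LT := 0 } hKQ hKQ hOV hOV hE hF hF hη0
  refine ⟨h, s, r, CT, LT, hh, hs, hr, uθ, huθ, fun t ht => ?_⟩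
  calc ∑ x : DFM.State d M, (∑ y, (uθ (DFM.embed x t) y - u x t y) ^ 2) * DFM.path κ π t x
      ≤ ∑ _x : DFM.State d M, (∑ _y : Fin M, η ^ 2) * P := by
        refine Finset.sum_le_sum fun x _ => ?_
        refine (mul_le_mul_of_nonneg_left ((le_abs_self _).trans (hP t ht x))
          (Finset.sum_nonneg fun _ _ => sq_nonneg _)).trans
          (mul_le_mul_of_nonneg_right (Finset.sum_le_sum fun y _ => ?_) hP0)
        exact sq_le_sq.2 ((happrox t ht x y).trans (le_abs_self η))
    _ = A * (G / (A + 1)) := by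
        rw [← hηsq]
        simp only [Finset.sum_const, Finset.card_univ, nsmul_eq_mul, Fintype.card_fin, hA]
        ring
    _ ≤ G := by
        rw [← mul_div_assoc, div_le_iff₀ (by positivity)]
        nlinarith
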